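/- Let $W=W(x,y)$ be a cyclically reduced word in the free product $\langle x,y\mid x^2=y^3=1\rangle\cong\mathbb{Z}_2*\mathbb{Z}_3$, written with syllables $x$, $y$, $y^2$ (no negative exponents), of syllable length $2\ell$ with $\ell$ odd, such that the exponent sum of $y$ in $W$ is not divisible by $3$. Let $\tau_W(\lambda)\in\mathbb{C}[\lambda]$ be its trace polynomial, i.e. $\tau_W(\lambda)=\operatorname{tr}W(X,Y)$ for any matrices $X,Y\in \mathrm{SL}_2(\mathbb{C}[\lambda])$ with $\operatorname{tr}X=2\cos(\pi/2)=0$, $\operatorname{tr}Y=2\cos(\pi/3)=1$ and $\operatorname{tr}XY=\lambda$ (such matrices exist, and $\tau_W$ does not depend on their choice). Suppose that the group $$G=\langle x,y\mid x^2=y^3=W(x,y)^2=1\rangle$$ does not contain a non-abelian free subgroup. Then there are integers $c,e\ge 0$ such that $$\tau_W(\lambda)=\lambda(\lambda^2-2)^c(\lambda^4-3\lambda^2+1)^e,\qquad c\le 4,\qquad e\le 2c+2 .$$ In particular, $\ell=1+2c+4e\le 49$. -/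

import Mathlib

open Polynomial Matrix

noncomputable section

namespace TriangleGroup

/-- The two generators. -/
inductive Gen : Type
  | x : Gen
  | y : Gen

/-- The order of the cyclic factor generated by each generator. -/
def Gen.order (p q : ℕ) : Gen → ℕ
  | Gen.x => p
  | Gen.y => q

/-- A word written as a list of syllables; the pair `(g, k)` stands for the syllable `g ^ k`. -/
abbrev Word : Type := List (Gen × ℕ)

/-- The value of a syllable in a monoid, when `a`, `b` are substituted for `x`, `y`. -/
def evalSyllable {M : Type*} [Monoid M] (a b : M) : Gen × ℕ → M
  | (Gen.x, k) => a ^ k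
  | (Gen.y, k) => b ^ k

/-- The value `W(a, b)` of a word in a monoid. -/
def evalWord {M : Type*} [Monoid M] (a b : M) (w : Word) : M :=
  (w.map (evalSyllable a b)).prod

/-- The contribution of a syllable to the exponent sum of `y`. -/
def yExponent : Gen × ℕ → ℕ
  | (Gen.x, _) => 0
  | (Gen.y, k) => k

/-- The exponent sum of `y` in a word. -/
def yExponentSum (w : Word) : ℕ := (w.map yExponent).sum

/-- `w` is a cyclically reduced word of the free product
`⟨x, y | x ^ p = y ^ q = 1⟩ ≅ ℤ/p * ℤ/q`, in normal form: each syllable is a non-trivial element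
of its factor, written with its exponent in `{1, …, p - 1}` respectively `{1, …, q - 1}`;
adjacent syllables lie in different factors, and so do the first and the last one (if there are
at least two). -/
structure IsCyclicallyReduced (p q : ℕ) (w : Word) : Prop where
  exponents : ∀ s ∈ w, 0 < s.2 ∧ s.2 < s.1.order p q
  alternating : w.IsChain (fun s t => s.1 ≠ t.1)
  ends : 2 ≤ w.length → ∀ s ∈ w.head?, ∀ t ∈ w.getLast?, s.1 ≠ t.1

/-- The group `⟨x, y | x ^ p = y ^ q = W(x, y) ^ r = 1⟩`. -/
abbrev GeneralisedTriangleGroup (p q r : ℕ) (w : Word) : Type :=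
  PresentedGroup
    ({FreeGroup.of Gen.x ^ p, FreeGroup.of Gen.y ^ q,
      evalWord (FreeGroup.of Gen.x) (FreeGroup.of Gen.y) w ^ r} : Set (FreeGroup Gen))

/-- `G` has a subgroup that is free and non-abelian. -/
def ContainsNonabelianFreeSubgroup (G : Type*) [Group G] : Prop :=
  ∃ H : Subgroup G, IsFreeGroup H ∧ ∃ a b : H, a * b ≠ b * a

/-- The number `exp(iπ/n)`, with `ζ n + (ζ n)⁻¹ = 2 cos(π/n)`. -/
def zeta (n : ℕ) : ℂ := Complex.exp (Real.pi * Complex.I / n)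

theorem zeta_ne_zero (n : ℕ) : zeta n ≠ 0 := Complex.exp_ne_zero _

theorem zeta_add_inv (n : ℕ) : zeta n + (zeta n)⁻¹ = ((2 * Real.cos (Real.pi / n) : ℝ) : ℂ) := by
  push_cast
  rw [Complex.two_cos, zeta, ← Complex.exp_neg]
  congr 2 <;> ring

theorem C_zeta_mul_inv (n : ℕ) : (C (zeta n) * C (zeta n)⁻¹ : ℂ[X]) = 1 := by
  rw [← C_mul, mul_inv_cancel₀ (zeta_ne_zero n), C_1]

/-- A matrix over `ℂ[λ]` of determinant `1` and trace `2 cos(π/p)`. -/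
def matX (p : ℕ) : Matrix (Fin 2) (Fin 2) ℂ[X] :=
  !![C (zeta p), 0; 1, C (zeta p)⁻¹]

/-- A matrix over `ℂ[λ]` of determinant `1` and trace `2 cos(π/q)`, whose product with `matX p`
has trace `λ`. -/
def matY (p q : ℕ) : Matrix (Fin 2) (Fin 2) ℂ[X] :=
  !![C (zeta q), X - C (zeta p) * C (zeta q) - C (zeta p)⁻¹ * C (zeta q)⁻¹;
     0, C (zeta q)⁻¹]

/-- `A` and `B` are matrices in `SL₂(ℂ[λ])` with the traces that define the trace polynomial:
`tr A = 2 cos(π/p)`, `tr B = 2 cos(π/q)`, `tr (A B) = λ`. -/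
structure IsTracePair (p q : ℕ) (A B : Matrix (Fin 2) (Fin 2) ℂ[X]) : Prop where
  det_left : A.det = 1
  det_right : B.det = 1
  trace_left : A.trace = C ((2 * Real.cos (Real.pi / p) : ℝ) : ℂ)
  trace_right : B.trace = C ((2 * Real.cos (Real.pi / q) : ℝ) : ℂ)
  trace_mul : (A * B).trace = X

theorem isTracePair_mat (p q : ℕ) : IsTracePair p q (matX p) (matY p q) := by
  refine ⟨?_, ?_, ?_, ?_, ?_⟩
  · rw [matX, Matrix.det_fin_two_of, C_zeta_mul_inv]; simp
  · rw [matY, Matrix.det_fin_two_of, C_zeta_mul_inv]; simp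
  · rw [← zeta_add_inv, C_add, matX, Matrix.trace_fin_two_of]
  · rw [← zeta_add_inv, C_add, matY, Matrix.trace_fin_two_of]
  · rw [matX, matY, Matrix.mul_fin_two, Matrix.trace_fin_two_of]; ring

/-- The trace polynomial `τ_W(λ) = tr W(A, B) ∈ ℂ[λ]`, where `A, B ∈ SL₂(ℂ[λ])` satisfy
`tr A = 2 cos(π/p)`, `tr B = 2 cos(π/q)` and `tr (A B) = λ`. It does not depend on the choice of
`A` and `B`, see `tracePolynomial_eq`. -/
def tracePolynomial (p q : ℕ) (w : Word) : ℂ[X] :=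
  (evalWord (matX p) (matY p q) w).trace

theorem tracePolynomial_aux {R : Type*} [CommRing R] (a b c : R) (w : Word) :
    ∃ k₀ k₁ k₂ k₃ : R, ∀ A B : Matrix (Fin 2) (Fin 2) R,
      A.det = 1 → B.det = 1 → A.trace = a → B.trace = b → (A * B).trace = c →
      evalWord A B w = k₀ • (1 : Matrix (Fin 2) (Fin 2) R) + k₁ • A + k₂ • B
        + k₃ • (A * B) := by
  -- left multiplication by `A` and by `B` acts on the combinations through the traces only
  have keyA : ∀ A : Matrix (Fin 2) (Fin 2) R, A.det = 1 → A.trace = a → A * A = a • A - 1 := by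
    rintro A h rfl
    rw [Matrix.det_fin_two] at h
    ext i j
    fin_cases i <;> fin_cases j <;>
      simp [Matrix.mul_apply, Fin.sum_univ_two, Matrix.trace_fin_two] <;>
        first | ring1 | linear_combination -h
  have keyB : ∀ B : Matrix (Fin 2) (Fin 2) R, B.det = 1 → B.trace = b → B * B = b • B - 1 := by
    rintro B h rfl
    rw [Matrix.det_fin_two] at h
    ext i j
    fin_cases i <;> fin_cases j <;>
      simp [Matrix.mul_apply, Fin.sum_univ_two, Matrix.trace_fin_two] <;>
        first | ring1 | linear_combination -h
  have keyBA : ∀ A B : Matrix (Fin 2) (Fin 2) R,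
      A.det = 1 → B.det = 1 → A.trace = a → B.trace = b → (A * B).trace = c →
      B * A = (c - a * b) • (1 : Matrix (Fin 2) (Fin 2) R) + b • A + a • B
        - A * B := by
    rintro A B - - rfl rfl rfl
    ext i j
    fin_cases i <;> fin_cases j <;>
      simp [Matrix.mul_apply, Fin.sum_univ_two, Matrix.trace_fin_two] <;> ring
  have stepA : ∀ (n : ℕ) (k₀ k₁ k₂ k₃ : R), ∃ l₀ l₁ l₂ l₃ : R,
      ∀ A B : Matrix (Fin 2) (Fin 2) R,
      A.det = 1 → B.det = 1 → A.trace = a → B.trace = b → (A * B).trace = c →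
      A ^ n * (k₀ • (1 : Matrix (Fin 2) (Fin 2) R) + k₁ • A + k₂ • B + k₃ • (A * B))
        = l₀ • (1 : Matrix (Fin 2) (Fin 2) R) + l₁ • A + l₂ • B + l₃ • (A * B) := by
    intro n
    induction n with
    | zero => intro k₀ k₁ k₂ k₃; exact ⟨k₀, k₁, k₂, k₃, by simp⟩
    | succ n ih =>
      intro k₀ k₁ k₂ k₃
      obtain ⟨l₀, l₁, l₂, l₃, h⟩ := ih (-k₁) (k₀ + a * k₁) (-k₃) (k₂ + a * k₃)
      refine ⟨l₀, l₁, l₂, l₃, fun A B dA dB hA hB hAB => ?_⟩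
      rw [← h A B dA dB hA hB hAB, pow_succ, mul_assoc]
      congr 1
      simp only [mul_add, Matrix.mul_smul, ← mul_assoc, keyA A dA hA, mul_one, sub_mul, one_mul,
        Matrix.smul_mul, smul_sub]
      module
  have stepB : ∀ (n : ℕ) (k₀ k₁ k₂ k₃ : R), ∃ l₀ l₁ l₂ l₃ : R,
      ∀ A B : Matrix (Fin 2) (Fin 2) R,
      A.det = 1 → B.det = 1 → A.trace = a → B.trace = b → (A * B).trace = c →
      B ^ n * (k₀ • (1 : Matrix (Fin 2) (Fin 2) R) + k₁ • A + k₂ • B + k₃ • (A * B))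
        = l₀ • (1 : Matrix (Fin 2) (Fin 2) R) + l₁ • A + l₂ • B + l₃ • (A * B) := by
    intro n
    induction n with
    | zero => intro k₀ k₁ k₂ k₃; exact ⟨k₀, k₁, k₂, k₃, by simp⟩
    | succ n ih =>
      intro k₀ k₁ k₂ k₃
      obtain ⟨l₀, l₁, l₂, l₃, h⟩ := ih (k₁ * (c - a * b) - k₂ - k₃ * a) (k₁ * b + k₃)
        (k₀ + k₁ * a + k₂ * b + k₃ * c) (-k₁)
      refine ⟨l₀, l₁, l₂, l₃, fun A B dA dB hA hB hAB => ?_⟩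
      rw [← h A B dA dB hA hB hAB, pow_succ, mul_assoc]
      congr 1
      simp only [mul_add, Matrix.mul_smul, ← mul_assoc, keyBA A B dA dB hA hB hAB, mul_one, sub_mul,
        add_mul, one_mul, Matrix.smul_mul, smul_sub, smul_add]
      simp only [mul_assoc, keyB B dB hB, mul_sub, Matrix.mul_smul, mul_one, smul_sub]
      module
  induction w with
  | nil => exact ⟨1, 0, 0, 0, by simp [evalWord]⟩
  | cons s w ih =>
    obtain ⟨k₀, k₁, k₂, k₃, h⟩ := ih
    obtain ⟨g, n⟩ := s
    have hc : ∀ A B : Matrix (Fin 2) (Fin 2) R, evalWord A B ((g, n) :: w)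
        = evalSyllable A B (g, n) * evalWord A B w := by
      intro A B; simp [evalWord]
    cases g with
    | x =>
      obtain ⟨l₀, l₁, l₂, l₃, h'⟩ := stepA n k₀ k₁ k₂ k₃
      refine ⟨l₀, l₁, l₂, l₃, fun A B dA dB hA hB hAB => ?_⟩
      rw [hc, h A B dA dB hA hB hAB, ← h' A B dA dB hA hB hAB]
      simp [evalSyllable]
    | y =>
      obtain ⟨l₀, l₁, l₂, l₃, h'⟩ := stepB n k₀ k₁ k₂ k₃
      refine ⟨l₀, l₁, l₂, l₃, fun A B dA dB hA hB hAB => ?_⟩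
      rw [hc, h A B dA dB hA hB hAB, ← h' A B dA dB hA hB hAB]
      simp [evalSyllable]

/-- The trace polynomial does not depend on the choice of the matrices. -/
theorem tracePolynomial_eq (p q : ℕ) (w : Word) (A B : Matrix (Fin 2) (Fin 2) ℂ[X])
    (h : IsTracePair p q A B) :
    tracePolynomial p q w = (evalWord A B w).trace := by
  obtain ⟨k₀, k₁, k₂, k₃, hk⟩ := tracePolynomial_aux (C ((2 * Real.cos (Real.pi / p) : ℝ) : ℂ))
    (C ((2 * Real.cos (Real.pi / q) : ℝ) : ℂ)) (X : ℂ[X]) w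
  obtain ⟨e₁, e₂, h₁, h₂, h₃⟩ := h
  obtain ⟨f₁, f₂, m₁, m₂, m₃⟩ := isTracePair_mat p q
  rw [tracePolynomial, hk _ _ f₁ f₂ m₁ m₂ m₃, hk _ _ e₁ e₂ h₁ h₂ h₃]
  simp only [Matrix.trace_add, Matrix.trace_smul, h₁, h₂, h₃, m₁, m₂, m₃]

end TriangleGroup

end

open scoped MatrixGroups

namespace TriangleGroup

/-! The trace polynomial `τ` has integer coefficients and is monic of degree `ℓ`. A complex zero `c`
of `τ` gives matrices `A`, `B` with `tr A = 0`, `tr B = 1`, `tr AB = c` and `tr W(A, B) = 0`. Then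
`A²`, `B³` and `W²` all equal `-1`, so `G` acts through `PSL₂(ℂ)`. If `c` is not a real number in
`[-√3, √3]`, then `AB` or the commutator `[A, B]`, whose trace is `c² - 1`, is loxodromic, and
ping-pong produces a free subgroup (`containsNonabelianFreeSubgroup_of_root`). Hence all zeros of
`τ` lie in `[-√3, √3]`.

Put `u = z²(3 - z²)` for a zero `z`. All conjugates of `u` lie in `[0, 9/4]`, where `|u(u - 1)(u -
2)| < 1`, so this algebraic integer vanishes (`cubic_eq_zero_of_root`). Only the factors `λ`, `λ ±
1`, `λ² - 2` and `λ² ± λ - 1` remain, because `τ² = 3` at `λ² = 3`, where a diagonal representation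
can be used.

The values at `±√3` force one factor `λ` and no `λ ± 1`. The equality `τ(2)² = τ(-2)²` makes the
last two multiplicities equal, and their product is `λ⁴ - 3λ² + 1`. Finally `|τ| ≤ 2` on `[-√3,
√3]`, where the representation is unitary; two sample points then bound the exponents. -/

/-! ### Ping-pong in `SL₂(ℂ)` -/

/-- The action of `SL₂(ℂ)` on the non-zero vectors of `ℂ²`. -/
instance nonzeroVectorAction : MulAction SL(2, ℂ) {v : Fin 2 → ℂ // v ≠ 0} where
  smul g v := ⟨g.1 *ᵥ v.1, fun h => v.2 (by
    have h1 : (g⁻¹).1 *ᵥ (g.1 *ᵥ v.1) = v.1 := by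
      rw [Matrix.mulVec_mulVec, ← Matrix.SpecialLinearGroup.coe_mul, inv_mul_cancel,
        Matrix.SpecialLinearGroup.coe_one, Matrix.one_mulVec]
    rw [← h1, h, Matrix.mulVec_zero])⟩
  one_smul v := Subtype.ext (by
    change (1 : SL(2, ℂ)).1 *ᵥ v.1 = v.1
    simp)
  mul_smul g h v := Subtype.ext (by
    change (g * h).1 *ᵥ v.1 = g.1 *ᵥ (h.1 *ᵥ v.1)
    rw [Matrix.mulVec_mulVec, Matrix.SpecialLinearGroup.coe_mul])

theorem coe_smul_nonzeroVector (g : SL(2, ℂ)) (v : {v : Fin 2 → ℂ // v ≠ 0}) :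
    (g • v).1 = g.1 *ᵥ v.1 := rfl

/-- A linear estimate that keeps the images of two narrow cones apart. -/
theorem norm_add_le_of_cone {a b c d u v : ℂ} {R : ℝ} (hR : 1 ≤ R)
    (h1 : 2 * ‖d‖ ≤ R * ‖c‖) (h2 : 2 * (‖a‖ + ‖b‖) ≤ R * ‖c‖) (huv : R * ‖v‖ < ‖u‖) :
    ‖a * u + b * v‖ ≤ R * ‖c * u + d * v‖ := by
  have hu : 0 ≤ ‖u‖ := norm_nonneg u
  have hv : ‖v‖ ≤ ‖u‖ := by nlinarith [norm_nonneg v]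
  -- On the cone the left side is at most `(‖a‖ + ‖b‖)‖u‖`, while `‖d * v‖` uses up at most half of
  -- `‖c * u‖`.
  have e1 : ‖a * u + b * v‖ ≤ (‖a‖ + ‖b‖) * ‖u‖ := by
    refine (norm_add_le _ _).trans ?_
    rw [norm_mul, norm_mul, add_mul]
    gcongr
  have e2 : ‖c‖ * ‖u‖ ≤ ‖c * u + d * v‖ + ‖d‖ * ‖v‖ := by
    rw [← norm_mul, ← norm_mul]
    simpa using norm_sub_le (c * u + d * v) (d * v)
  have e3 : R * (2 * (‖d‖ * ‖v‖)) ≤ R * (‖c‖ * ‖u‖) := by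
    calc R * (2 * (‖d‖ * ‖v‖)) = (2 * ‖d‖) * (R * ‖v‖) := by ring
      _ ≤ (R * ‖c‖) * ‖u‖ := by gcongr
      _ = _ := by ring
  nlinarith [mul_le_mul_of_nonneg_right h2 hu, mul_le_mul_of_nonneg_left e2 (by linarith : 0 ≤ R)]

/-- A ping-pong criterion for an element and its conjugate. -/
theorem injective_lift_conj_of_ping_pong {G : Type} {α : Type*} [Group G] [MulAction G α] {g k : G}
    {A B : Set α} (hne : A.Nonempty) (hAB : Disjoint A B) (key : ∀ v ∈ A ∪ B, k⁻¹ • v ∉ A ∪ B)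
    (hgA : ∀ v, v ∉ B → g • v ∈ A) (hgB : ∀ v, v ∉ A → g⁻¹ • v ∈ B) :
    Function.Injective (FreeGroup.lift (fun i : Bool => cond i g (k * g * k⁻¹))) := by
  -- The four ping-pong sets are `A`, `B`, `kA`, `kB`; `key` says that `k` moves `A ∪ B` off itself.
  refine FreeGroup.injective_lift_of_ping_pong (G := G) (α := α)
    (X := fun i : Bool => cond i A {v : α | k⁻¹ • v ∈ A})
    (Y := fun i : Bool => cond i B {v : α | k⁻¹ • v ∈ B}) _ ?_ ?_ ?_ ?_ ?_ ?_
  · obtain ⟨a, h0⟩ := hne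
    rintro (_ | _)
    · exact ⟨k • a, by simpa using h0⟩
    · exact ⟨a, h0⟩
  · rintro (_ | _) (_ | _) h
    · exact absurd rfl h
    · exact Set.disjoint_left.2 fun v h1 h2 => key v (Or.inl h2) (Or.inl h1)
    · exact Set.disjoint_left.2 fun v h1 h2 => key v (Or.inl h1) (Or.inl h2)
    · exact absurd rfl h
  · rintro (_ | _) (_ | _) h
    · exact absurd rfl h
    · exact Set.disjoint_left.2 fun v h1 h2 => key v (Or.inr h2) (Or.inr h1)
    · exact Set.disjoint_left.2 fun v h1 h2 => key v (Or.inr h1) (Or.inr h2)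
    · exact absurd rfl h
  · rintro (_ | _) (_ | _)
    · exact Set.disjoint_left.2 fun v h1 h2 => Set.disjoint_left.1 hAB h1 h2
    · exact Set.disjoint_left.2 fun v h1 h2 => key v (Or.inr h2) (Or.inl h1)
    · exact Set.disjoint_left.2 fun v h1 h2 => key v (Or.inl h1) (Or.inr h2)
    · exact hAB
  · rintro (_ | _) _ ⟨v, hv, rfl⟩
    · simpa [mul_smul] using hgA _ hv
    · exact hgA _ hv
  · rintro (_ | _) _ ⟨v, hv, rfl⟩
    · simpa [mul_smul] using hgB _ hv
    · exact hgB _ hv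

/-- A loxodromic diagonal matrix and its conjugate by a matrix without zero entries have powers
that generate a free group. -/
theorem exists_pow_injective_lift {t : ℂ} (ht : 1 < ‖t‖) (g k : SL(2, ℂ))
    (hg : g.1 = !![t, 0; 0, t⁻¹]) (hk : ∀ i j, k.1 i j ≠ 0) :
    ∃ n : ℕ, Function.Injective
      (FreeGroup.lift (fun i : Bool => cond i (g ^ n) (k * g ^ n * k⁻¹))) := by
  obtain ⟨R, hR1, hR⟩ : ∃ R : ℝ, 1 ≤ R ∧ ∀ i j i' j' i'' j'',
      2 * (‖k.1 i j‖ + ‖k.1 i' j'‖) ≤ R * ‖k.1 i'' j''‖ := by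
    have hpos : ∀ i j, 0 < ‖k.1 i j‖ := fun i j => norm_pos_iff.2 (hk i j)
    set M := ∑ i, ∑ j, ‖k.1 i j‖ with hM
    have hle : ∀ i j, ‖k.1 i j‖ ≤ M := fun i j =>
      (Finset.single_le_sum (f := fun j => ‖k.1 i j‖) (fun _ _ => norm_nonneg _)
        (Finset.mem_univ j)).trans
      (Finset.single_le_sum (f := fun i => ∑ j, ‖k.1 i j‖)
        (fun _ _ => Finset.sum_nonneg fun _ _ => norm_nonneg _) (Finset.mem_univ i))
    set N := ∑ i, ∑ j, ‖k.1 i j‖⁻¹ with hN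
    have hle' : ∀ i j, ‖k.1 i j‖⁻¹ ≤ N := fun i j =>
      (Finset.single_le_sum (f := fun j => ‖k.1 i j‖⁻¹) (fun _ _ => by positivity)
        (Finset.mem_univ j)).trans
      (Finset.single_le_sum (f := fun i => ∑ j, ‖k.1 i j‖⁻¹)
        (fun _ _ => Finset.sum_nonneg fun _ _ => by positivity) (Finset.mem_univ i))
    have hM0 : 0 ≤ M := (norm_nonneg _).trans (hle 0 0)
    have hN0 : 0 ≤ N := (inv_nonneg.2 (norm_nonneg _)).trans (hle' 0 0)
    -- Every entry has norm at most `M` and at least `1 / N`, so `4MN` exceeds all the ratios in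
    -- question.
    refine ⟨1 + 4 * M * N, by nlinarith [mul_nonneg hM0 hN0], fun i j i' j' i'' j'' => ?_⟩
    have h1 : 1 ≤ N * ‖k.1 i'' j''‖ := by
      have := mul_le_mul_of_nonneg_right (hle' i'' j'') (hpos i'' j'').le
      rwa [inv_mul_cancel₀ (hpos i'' j'').ne'] at this
    nlinarith [hle i j, hle i' j', hpos i'' j'', mul_le_mul_of_nonneg_left h1 hM0]
  have hRd : ∀ i j i'' j'', 2 * ‖k.1 i j‖ ≤ R * ‖k.1 i'' j''‖ := fun i j i'' j'' => by
    have := hR i j i j i'' j''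
    nlinarith [norm_nonneg (k.1 i j)]
  -- The power `gⁿ` multiplies the ratio of the coordinates by `t²ⁿ`; `R²` is what is needed to pass
  -- from the complement of one cone into the other.
  obtain ⟨n, hn⟩ := pow_unbounded_of_one_lt (R * R) ht
  refine ⟨n, ?_⟩
  have ht0 : t ≠ 0 := fun h => by simp [h] at ht; linarith
  have hgn : ∀ n : ℕ, (g ^ n).1 = !![t ^ n, 0; 0, (t ^ n)⁻¹] := by
    intro n
    induction n with
    | zero => ext i j; fin_cases i <;> fin_cases j <;> simp
    | succ n ih =>
      rw [pow_succ, Matrix.SpecialLinearGroup.coe_mul, ih, hg, Matrix.mul_fin_two, pow_succ]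
      simp [mul_comm]
  have hgi : ((g ^ n)⁻¹).1 = !![(t ^ n)⁻¹, 0; 0, t ^ n] := by
    rw [Matrix.SpecialLinearGroup.SL2_inv_expl]
    simp only [hgn]
    ext i j; fin_cases i <;> fin_cases j <;> simp
  have hki : k⁻¹.1 = !![k.1 1 1, - k.1 0 1; - k.1 1 0, k.1 0 0] :=
    congrArg Subtype.val (Matrix.SpecialLinearGroup.SL2_inv_expl k)
  set A : Set {v : Fin 2 → ℂ // v ≠ 0} := {v | R * ‖v.1 1‖ < ‖v.1 0‖} with hA
  set B : Set {v : Fin 2 → ℂ // v ≠ 0} := {v | R * ‖v.1 0‖ < ‖v.1 1‖} with hB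
  have hAB : Disjoint A B := by
    rw [Set.disjoint_left]
    intro v h1 h2
    simp only [hA, hB, Set.mem_ofPred_eq] at h1 h2
    nlinarith [norm_nonneg (v.1 0), norm_nonneg (v.1 1)]
  -- As `k` has no zero entry, `k⁻¹` maps neither coordinate axis to a coordinate axis; `R` is large
  -- enough for the same to hold for the cones around the axes.
  have key : ∀ v : {v : Fin 2 → ℂ // v ≠ 0}, v ∈ A ∪ B → k⁻¹ • v ∉ A ∪ B := by
    have hsv : ∀ v : {v : Fin 2 → ℂ // v ≠ 0}, (k⁻¹ • v).1
        = ![k.1 1 1 * v.1 0 + - k.1 0 1 * v.1 1, - k.1 1 0 * v.1 0 + k.1 0 0 * v.1 1] := by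
      intro v
      rw [coe_smul_nonzeroVector, hki]
      ext i; fin_cases i <;> simp [Matrix.mulVec, dotProduct, Fin.sum_univ_two]
    intro v hv hv'
    simp only [hA, hB, Set.mem_union, Set.mem_ofPred_eq, hsv] at hv hv'
    simp only [Matrix.cons_val_zero, Matrix.cons_val_one] at hv'
    rcases hv with hv | hv
    · rcases hv' with hv' | hv'
      · refine hv'.not_ge (norm_add_le_of_cone hR1 ?_ ?_ hv) <;> simp only [norm_neg]
        exacts [hRd 0 0 1 0, hR 1 1 0 1 1 0]
      · refine hv'.not_ge (norm_add_le_of_cone hR1 ?_ ?_ hv) <;> simp only [norm_neg]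
        exacts [hRd 0 1 1 1, hR 1 0 0 0 1 1]
    · rw [add_comm (k.1 1 1 * _), add_comm (-k.1 1 0 * _)] at hv'
      rcases hv' with hv' | hv'
      · refine hv'.not_ge (norm_add_le_of_cone hR1 ?_ ?_ hv) <;> simp only [norm_neg]
        exacts [hRd 1 0 0 0, hR 0 1 1 1 0 0]
      · refine hv'.not_ge (norm_add_le_of_cone hR1 ?_ ?_ hv) <;> simp only [norm_neg]
        exacts [hRd 1 1 0 1, hR 0 0 1 0 0 1]
  have hne : ∀ v : {v : Fin 2 → ℂ // v ≠ 0}, v.1 0 = 0 → v.1 1 ≠ 0 := fun v h0 h1 =>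
    v.2 (by ext i; fin_cases i <;> assumption)
  have hne' : ∀ v : {v : Fin 2 → ℂ // v ≠ 0}, v.1 1 = 0 → v.1 0 ≠ 0 := fun v h1 h0 =>
    hne v h0 h1
  have htn : 0 < ‖t ^ n‖ := norm_pos_iff.2 (pow_ne_zero _ ht0)
  rw [← norm_pow] at hn
  have grow : ∀ a b : ℂ, ‖b‖ ≤ R * ‖a‖ → a ≠ 0 → R * ‖(t ^ n)⁻¹ * b‖ < ‖t ^ n * a‖ := by
    intro a b hab ha
    have hR0 : 0 < R := by linarith
    have ha' : 0 < ‖a‖ := norm_pos_iff.2 ha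
    rw [norm_mul, norm_mul, norm_inv]
    have hT1 : 1 ≤ ‖t ^ n‖ := by nlinarith
    calc R * (‖t ^ n‖⁻¹ * ‖b‖) ≤ R * (1 * (R * ‖a‖)) := by
          gcongr
          exact inv_le_one_of_one_le₀ hT1
      _ = (R * R) * ‖a‖ := by ring
      _ < _ := by gcongr
  have hgA : ∀ v, v ∉ B → g ^ n • v ∈ A := by
    intro v hv
    simp only [hA, hB, Set.mem_ofPred_eq, not_lt, coe_smul_nonzeroVector, hgn] at hv ⊢
    have h0 : v.1 0 ≠ 0 := fun h => hne v h (by simpa [h] using hv)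
    simpa [Matrix.mulVec, dotProduct, Fin.sum_univ_two] using grow _ _ hv h0
  have hgB : ∀ v, v ∉ A → (g ^ n)⁻¹ • v ∈ B := by
    intro v hv
    simp only [hA, hB, Set.mem_ofPred_eq, not_lt, coe_smul_nonzeroVector, hgi] at hv ⊢
    have h0 : v.1 1 ≠ 0 := fun h => hne' v h (by simpa [h] using hv)
    simpa [Matrix.mulVec, dotProduct, Fin.sum_univ_two] using grow _ _ hv h0
  exact injective_lift_conj_of_ping_pong (A := A) (B := B)
    ⟨⟨![1, 0], fun h => one_ne_zero (congrFun h 0)⟩, by simp [hA]⟩ hAB key hgA hgB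

/-! ### From representations to free subgroups of `G` -/

theorem evalWord_cons {M : Type*} [Monoid M] (a b : M) (s : Gen × ℕ) (w : Word) :
    evalWord a b (s :: w) = evalSyllable a b s * evalWord a b w := by
  simp [evalWord]

theorem evalWord_append {M : Type*} [Monoid M] (a b : M) (v w : Word) :
    evalWord a b (v ++ w) = evalWord a b v * evalWord a b w := by
  simp [evalWord]

theorem map_evalWord {M N : Type*} [Monoid M] [Monoid N] (f : M →* N) (a b : M) (w : Word) :
    f (evalWord a b w) = evalWord (f a) (f b) w := by
  induction w with
  | nil => simp [evalWord]
  | cons s w ih =>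
    obtain ⟨_ | _, n⟩ := s <;> simp [evalWord_cons, evalSyllable, ih]

theorem evalWord_mem {M : Type*} [Monoid M] (S : Submonoid M) {a b : M} (ha : a ∈ S) (hb : b ∈ S)
    (w : Word) : evalWord a b w ∈ S := by
  induction w with
  | nil => simp [evalWord]
  | cons s w ih =>
    rw [evalWord_cons]
    refine S.mul_mem ?_ ih
    obtain ⟨_ | _, n⟩ := s
    exacts [S.pow_mem ha n, S.pow_mem hb n]

/-- The function on the generators with values `a` at `x` and `b` at `y`. -/
def generatorValue {M : Type*} (a b : M) : Gen → M
  | Gen.x => a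
  | Gen.y => b

/-- A representation in `SL₂(ℂ)` which maps the relators to `-1`, and whose image contains a
loxodromic diagonal matrix and a matrix without zero entries, yields a free subgroup. -/
theorem containsNonabelianFreeSubgroup_of_representation {w : Word} {A B : SL(2, ℂ)}
    (hA : A ^ 2 = -1) (hB : B ^ 3 = -1) (hW : evalWord A B w ^ 2 = -1) (g k : FreeGroup Gen)
    {t : ℂ} (ht : 1 < ‖t‖)
    (hg : (FreeGroup.lift (generatorValue A B) g).1 = !![t, 0; 0, t⁻¹])
    (hk : ∀ i j, (FreeGroup.lift (generatorValue A B) k).1 i j ≠ 0) :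
    ContainsNonabelianFreeSubgroup (GeneralisedTriangleGroup 2 3 2 w) := by
  set ψ : FreeGroup Gen →* SL(2, ℂ) := FreeGroup.lift (generatorValue A B) with hψ
  obtain ⟨n, hn⟩ := exists_pow_injective_lift ht (ψ g) (ψ k) hg hk
  set f : FreeGroup Bool →* FreeGroup Gen :=
    FreeGroup.lift (fun i : Bool => cond i (g ^ n) (k * g ^ n * k⁻¹)) with hf
  have hψf : FreeGroup.lift (fun i : Bool => cond i (ψ g ^ n) (ψ k * ψ g ^ n * (ψ k)⁻¹))
      = ψ.comp f := by
    ext i : 1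
    cases i <;> simp [hf]
  rw [hψf] at hn
  set rels : Set (FreeGroup Gen) := {FreeGroup.of Gen.x ^ 2, FreeGroup.of Gen.y ^ 3,
      evalWord (FreeGroup.of Gen.x) (FreeGroup.of Gen.y) w ^ 2} with hrels
  -- The relators go to `-1`, so `ψ` descends to `G` only modulo the central subgroup `{1, -1}`.
  have hker : ∀ u ∈ Subgroup.normalClosure rels, ψ u = 1 ∨ ψ u = -1 := by
    have hx : ψ (FreeGroup.of Gen.x) = A := by simp [hψ, generatorValue]
    have hy : ψ (FreeGroup.of Gen.y) = B := by simp [hψ, generatorValue]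
    let N : Subgroup (FreeGroup Gen) :=
      { carrier := {u | ψ u = 1 ∨ ψ u = -1}
        one_mem' := Or.inl (map_one ψ)
        mul_mem' := by
          rintro a b (ha | ha) (hb | hb) <;> simp [ha, hb]
        inv_mem' := by
          rintro a (ha | ha) <;> simp [ha] }
    have hN : N.Normal := ⟨by
      rintro a (ha | ha) b
      · exact Or.inl (by simp [ha])
      · exact Or.inr (by simp [ha])⟩
    have hle : Subgroup.normalClosure rels ≤ N := by
      refine Subgroup.normalClosure_le_normal ?_
      rintro r (rfl | rfl | rfl)
      · exact Or.inr (by simp [hx, hA])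
      · exact Or.inr (by simp [hy, hB])
      · exact Or.inr (by simp [map_evalWord, hx, hy, hW])
    exact fun u hu => hle hu
  set π : FreeGroup Bool →* GeneralisedTriangleGroup 2 3 2 w :=
    (PresentedGroup.mk rels).comp f with hπ
  have hinj : Function.Injective π := by
    rw [injective_iff_map_eq_one]
    intro u hu
    have hu' : ψ (f u) = 1 ∨ ψ (f u) = -1 :=
      hker _ ((QuotientGroup.eq_one_iff (N := Subgroup.normalClosure rels) (f u)).1 hu)
    -- Squaring removes the sign, and a free group is torsion-free.
    have h2 : (ψ.comp f) (u ^ 2) = 1 := by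
      rw [map_pow, MonoidHom.comp_apply]
      rcases hu' with h | h <;> simp [h]
    have h3 : u ^ 2 = 1 := hn (by rw [h2, map_one])
    exact (pow_eq_one_iff_left two_ne_zero).1 h3
  let e : FreeGroup Bool ≃* π.range := MonoidHom.ofInjective hinj
  refine ⟨π.range, IsFreeGroup.ofMulEquiv e, e (FreeGroup.of true), e (FreeGroup.of false), ?_⟩
  rw [← map_mul, ← map_mul]
  intro h
  have := e.injective h
  revert this
  decide

/-! ### The trace polynomial over `ℤ`: integrality, degree, block form -/

theorem mul_self_of_det_eq_one {R : Type*} [CommRing R] {A : Matrix (Fin 2) (Fin 2) R}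
    (h : A.det = 1) : A * A = A.trace • A - 1 := by
  rw [Matrix.det_fin_two] at h
  ext i j
  fin_cases i <;> fin_cases j <;>
    simp [Matrix.mul_apply, Fin.sum_univ_two, Matrix.trace_fin_two] <;>
      first | ring1 | linear_combination -h

theorem mul_swap_of_trace {R : Type*} [CommRing R] (A B : Matrix (Fin 2) (Fin 2) R) :
    B * A = ((A * B).trace - A.trace * B.trace) • (1 : Matrix (Fin 2) (Fin 2) R) + B.trace • A
      + A.trace • B - A * B := by
  ext i j
  fin_cases i <;> fin_cases j <;>
    simp [Matrix.mul_apply, Fin.sum_univ_two, Matrix.trace_fin_two] <;> ring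

/-- Coordinates with respect to `1, A, B, AB`. -/
abbrev Coords : Type := ℤ[X] × ℤ[X] × ℤ[X] × ℤ[X]

/-- Left multiplication by `A`, when `tr A = 0`. -/
noncomputable def mulA (k : Coords) : Coords := (-k.2.1, k.1, -k.2.2.2, k.2.2.1)

/-- Left multiplication by `B`, when `tr A = 0`, `tr B = 1`, `tr AB = X`. -/
noncomputable def mulB (k : Coords) : Coords :=
  (X * k.2.1 - k.2.2.1, k.2.1 + k.2.2.2, k.1 + k.2.2.1 + X * k.2.2.2, -k.2.1)

/-- The coordinates of the value of a word. -/
noncomputable def wordCoords : Word → Coords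
  | [] => (1, 0, 0, 0)
  | (Gen.x, n) :: w => mulA^[n] (wordCoords w)
  | (Gen.y, n) :: w => mulB^[n] (wordCoords w)

/-- The trace polynomial of type `(2, 3)` over the integers. -/
noncomputable def intTrace (w : Word) : ℤ[X] :=
  2 * (wordCoords w).1 + (wordCoords w).2.2.1 + X * (wordCoords w).2.2.2

/-- The matrix with the given coordinates. -/
noncomputable def ofCoords {R : Type*} [CommRing R] (A B : Matrix (Fin 2) (Fin 2) R) (c : R) (k : Coords) :
    Matrix (Fin 2) (Fin 2) R :=
  aeval c k.1 • (1 : Matrix (Fin 2) (Fin 2) R) + aeval c k.2.1 • A + aeval c k.2.2.1 • B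
    + aeval c k.2.2.2 • (A * B)

section

variable {R : Type*} [CommRing R] {A B : Matrix (Fin 2) (Fin 2) R} {c : R}

theorem ofCoords_mulA (hA : A.det = 1) (tA : A.trace = 0) (k : Coords) :
    ofCoords A B c (mulA k) = A * ofCoords A B c k := by
  have h := mul_self_of_det_eq_one hA
  rw [tA, zero_smul, zero_sub] at h
  simp only [ofCoords, mulA, mul_add, Matrix.mul_smul, ← mul_assoc, h, mul_one, map_neg, neg_mul,
    one_mul]
  module

theorem ofCoords_mulB (hB : B.det = 1) (tA : A.trace = 0) (tB : B.trace = 1)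
    (tAB : (A * B).trace = c) (k : Coords) :
    ofCoords A B c (mulB k) = B * ofCoords A B c k := by
  have h := mul_self_of_det_eq_one hB
  have h' := mul_swap_of_trace A B
  rw [tB, one_smul] at h
  rw [tA, tB, tAB, zero_mul, sub_zero, one_smul, zero_smul, add_zero] at h'
  have h'' : B * (A * B) = c • B + A * B - (A * B - A) := by
    rw [← mul_assoc, h', sub_mul, add_mul, Matrix.smul_mul, one_mul, mul_assoc, h, mul_sub, mul_one]
  simp only [ofCoords, mulB, mul_add, Matrix.mul_smul, h, h', h'', mul_one, map_neg, map_add,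
    map_sub, map_mul, aeval_X]
  module

theorem evalWord_eq_ofCoords (hA : A.det = 1) (hB : B.det = 1) (tA : A.trace = 0)
    (tB : B.trace = 1) (tAB : (A * B).trace = c) (w : Word) :
    evalWord A B w = ofCoords A B c (wordCoords w) := by
  have ha : ∀ n k, ofCoords A B c (mulA^[n] k) = A ^ n * ofCoords A B c k := by
    intro n
    induction n with
    | zero => simp
    | succ n ih =>
      intro k
      rw [Function.iterate_succ_apply, ih, ofCoords_mulA hA tA, pow_succ, mul_assoc]
  have hb : ∀ n k, ofCoords A B c (mulB^[n] k) = B ^ n * ofCoords A B c k := by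
    intro n
    induction n with
    | zero => simp
    | succ n ih =>
      intro k
      rw [Function.iterate_succ_apply, ih, ofCoords_mulB hB tA tB tAB, pow_succ, mul_assoc]
  induction w with
  | nil => simp [evalWord, ofCoords, wordCoords]
  | cons s w ih =>
    obtain ⟨_ | _, n⟩ := s
    · rw [evalWord_cons, ih, wordCoords, ha, evalSyllable]
    · rw [evalWord_cons, ih, wordCoords, hb, evalSyllable]

theorem trace_evalWord (hA : A.det = 1) (hB : B.det = 1) (tA : A.trace = 0)
    (tB : B.trace = 1) (tAB : (A * B).trace = c) (w : Word) :
    (evalWord A B w).trace = aeval c (intTrace w) := by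
  rw [evalWord_eq_ofCoords hA hB tA tB tAB, ofCoords]
  simp only [Matrix.trace_add, Matrix.trace_smul, tA, tB, tAB, intTrace, map_add, map_mul, aeval_X,
    Matrix.trace_one, Fintype.card_fin, smul_eq_mul, map_ofNat]
  push_cast
  ring

end

theorem tracePolynomial_eq_map (w : Word) :
    tracePolynomial 2 3 w = (intTrace w).map (Int.castRingHom ℂ) := by
  obtain ⟨h1, h2, h3, h4, h5⟩ := isTracePair_mat 2 3
  rw [tracePolynomial, trace_evalWord h1 h2 (by simpa using h3) (by simpa using h4) h5]
  exact aeval_X_left_eq_map _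

/-- The word `x y ^ e₁ x y ^ e₂ ⋯`. -/
def blockWord (es : List ℕ) : Word := es.flatMap fun e => [(Gen.x, 1), (Gen.y, e)]

theorem blockWord_cons (e : ℕ) (es : List ℕ) :
    blockWord (e :: es) = (Gen.x, 1) :: (Gen.y, e) :: blockWord es := rfl

theorem X_mul_mem_degreeLT {n : ℕ} {p : ℤ[X]} (h : p ∈ degreeLT ℤ n) :
    X * p ∈ degreeLT ℤ (n + 1) := by
  rw [mem_degreeLT] at h ⊢
  by_cases hp : p = 0
  · simp [hp]
  rw [mul_comm, degree_mul_X, degree_eq_natDegree hp] at *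
  exact_mod_cast Nat.succ_lt_succ (by exact_mod_cast h)

theorem monic_add_X_mul {n : ℕ} {p q : ℤ[X]} (hp : p ∈ degreeLT ℤ (n + 1)) (hq : q.Monic)
    (hd : q.natDegree = n) : (p + X * q).Monic ∧ (p + X * q).natDegree = n + 1 := by
  rw [mem_degreeLT] at hp
  have hXq : (X * q).Monic := monic_X.mul hq
  have hdeg : (X * q).natDegree = n + 1 := by
    rw [monic_X.natDegree_mul hq, natDegree_X, hd, add_comm]
  have hlt : p.degree < (X * q).degree := by
    rwa [degree_eq_natDegree hXq.ne_zero, hdeg]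
  exact ⟨hXq.add_of_right hlt, by rw [natDegree_add_eq_right_of_degree_lt hlt, hdeg]⟩

/-- A further block sends `k₃` to `X * k₃` plus terms of lower degree, so the leading term sits in
the `AB` coordinate. The trace adds one more factor `X`, since `tr AB = X`. -/
theorem wordCoords_blockWord (es : List ℕ) (h : ∀ e ∈ es, e = 1 ∨ e = 2) {n : ℕ}
    (hn : es.length = n + 1) :
    ∃ k₀ k₁ k₂ k₃ : ℤ[X], wordCoords (blockWord es) = (k₀, k₁, k₂, k₃) ∧
      k₃.Monic ∧ k₃.natDegree = n ∧ k₀ ∈ degreeLT ℤ (n + 1) ∧ k₁ ∈ degreeLT ℤ (n + 1) ∧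
      k₂ ∈ degreeLT ℤ (n + 1) := by
  induction n generalizing es with
  | zero =>
    obtain ⟨e, rfl⟩ := List.length_eq_one_iff.1 hn
    rcases h e (by simp) with rfl | rfl
    · exact ⟨0, 0, 0, 1, by simp [blockWord, wordCoords, mulA, mulB], monic_one, natDegree_one,
        zero_mem _, zero_mem _, zero_mem _⟩
    · exact ⟨0, -1, 0, 1, by simp [blockWord, wordCoords, mulA, mulB], monic_one, natDegree_one,
        zero_mem _, by simp [mem_degreeLT], zero_mem _⟩
  | succ n ih =>
    obtain ⟨e, es, rfl⟩ := List.exists_cons_of_length_eq_add_one hn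
    obtain ⟨k₀, k₁, k₂, k₃, hk, hm, hd, h0, h1, h2⟩ :=
      ih es (fun e he => h e (by simp [he])) (by simpa using hn)
    have h3 : k₃ ∈ degreeLT ℤ (n + 1) := by
      rw [mem_degreeLT, degree_eq_natDegree hm.ne_zero, hd]
      exact_mod_cast n.lt_succ_self
    have hle : degreeLT ℤ (n + 1) ≤ degreeLT ℤ (n + 1 + 1) := degreeLT_mono (Nat.le_succ _)
    have hc : wordCoords (blockWord (e :: es)) = mulA (mulB^[e] (k₀, k₁, k₂, k₃)) := by
      rw [← hk]; rfl
    have hX1 := X_mul_mem_degreeLT h1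
    rcases h e (by simp) with rfl | rfl
    · obtain ⟨m1, m2⟩ := monic_add_X_mul (add_mem h0 h2) hm hd
      exact ⟨-(k₁ + k₃), X * k₁ - k₂, k₁, k₀ + k₂ + X * k₃,
        by rw [hc]; simp [mulA, mulB], m1, m2,
        hle (neg_mem (add_mem h1 h3)), sub_mem hX1 (hle h2), hle h1⟩
    · obtain ⟨m1, m2⟩ := monic_add_X_mul h0 hm hd
      exact ⟨-k₃, X * k₁ - k₀ - k₂, k₁ + k₃, k₀ + X * k₃,
        by rw [hc]; simp [mulA, mulB]; exact ⟨by ring, by ring⟩, m1, m2,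
        hle (neg_mem h3), sub_mem (sub_mem hX1 (hle h0)) (hle h2), hle (add_mem h1 h3)⟩

theorem intTrace_blockWord (es : List ℕ) (h : ∀ e ∈ es, e = 1 ∨ e = 2) (hne : es ≠ []) :
    (intTrace (blockWord es)).Monic ∧ (intTrace (blockWord es)).natDegree = es.length := by
  obtain ⟨n, hn⟩ := Nat.exists_eq_succ_of_ne_zero (mt List.length_eq_zero_iff.1 hne)
  obtain ⟨k₀, k₁, k₂, k₃, hk, hm, hd, h0, h1, h2⟩ := wordCoords_blockWord es h hn
  rw [hn, intTrace, hk]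
  exact monic_add_X_mul (add_mem (by rw [two_mul]; exact add_mem h0 h0) h2) hm hd

/-- A cyclically reduced word is, up to cyclic permutation, a product of blocks `x y ^ e`. -/
theorem exists_blockWord {ℓ : ℕ} {w : Word} (hred : IsCyclicallyReduced 2 3 w)
    (hlen : w.length = 2 * ℓ) :
    ∃ es : List ℕ, es.length = ℓ ∧ (∀ e ∈ es, e = 1 ∨ e = 2) ∧ es.sum = yExponentSum w ∧
      tracePolynomial 2 3 w = tracePolynomial 2 3 (blockWord es) := by
  have key : ∀ (ℓ : ℕ) (w : Word), w.length = 2 * ℓ → (∀ s ∈ w, 0 < s.2 ∧ s.2 < s.1.order 2 3) →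
      w.IsChain (fun s t => s.1 ≠ t.1) → (∀ s ∈ w.head?, s.1 = Gen.x) →
      ∃ es : List ℕ, es.length = ℓ ∧ (∀ e ∈ es, e = 1 ∨ e = 2) ∧ w = blockWord es := by
    intro ℓ
    induction ℓ with
    | zero => exact fun w hw _ _ _ => ⟨[], rfl, by simp, List.length_eq_zero_iff.1 hw⟩
    | succ ℓ ih =>
      intro w hw hexp hch hhead
      match w, hw with
      | (a, m) :: (b, e) :: w, hw =>
        obtain rfl : a = Gen.x := hhead _ rfl
        have hb : b = Gen.y := by
          have := (List.isChain_cons_cons.1 hch).1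
          cases b
          · exact absurd rfl this
          · rfl
        subst hb
        have hm := hexp (Gen.x, m) (by simp)
        have he := hexp (Gen.y, e) (by simp)
        simp only [Gen.order] at hm he
        obtain rfl : m = 1 := by omega
        obtain ⟨es, h1, h2, h3⟩ := ih w (by simp at hw; omega)
          (fun s hs => hexp s (by simp [hs])) hch.tail.tail (by
            intro s hs
            cases w with
            | nil => simp at hs
            | cons s' w =>
              obtain rfl : s' = s := by simpa using hs
              have := (List.isChain_cons_cons.1 hch.tail).1
              obtain ⟨_ | _, n⟩ := s'
              · rfl
              · exact absurd rfl this)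
        refine ⟨e :: es, by simp [h1], ?_, by rw [h3]; rfl⟩
        intro e' he'
        rcases List.mem_cons.1 he' with rfl | he'
        · omega
        · exact h2 e' he'
  have hsum : ∀ es : List ℕ, yExponentSum (blockWord es) = es.sum := by
    intro es
    induction es with
    | nil => rfl
    | cons e es ih =>
      rw [List.sum_cons, ← ih, blockWord_cons]
      simp [yExponentSum, yExponent]
  obtain ⟨hexp, hch, hends⟩ := hred
  cases w with
  | nil => exact ⟨[], by simp at hlen ⊢; omega, by simp, rfl, rfl⟩
  | cons s w =>
    obtain ⟨_ | _, e⟩ := s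
    · obtain ⟨es, h1, h2, h3⟩ := key ℓ _ hlen hexp hch (by simp)
      exact ⟨es, h1, h2, by rw [h3, hsum], by rw [h3]⟩
    · have hw : w ≠ [] := by
        rintro rfl
        simp at hlen
        omega
      have hends' := hends (by simp at hlen ⊢; omega) (Gen.y, e) rfl
      -- A word that begins with `y` becomes a product of blocks when its first syllable is moved to
      -- the end; the trace is unchanged.
      obtain ⟨es, h1, h2, h3⟩ := key ℓ (w ++ [(Gen.y, e)]) (by simpa using hlen)
        (fun s hs => hexp s (by simpa [or_comm] using hs))
        (by
          refine hch.tail.append (List.isChain_singleton _) ?_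
          intro a ha b hb
          obtain rfl : (Gen.y, e) = b := by simpa using hb
          refine (hends' a ?_).symm
          rwa [List.getLast?_cons_of_ne_nil hw])
        (by
          intro s hs
          cases w with
          | nil => exact absurd rfl hw
          | cons s' w =>
            obtain rfl : s' = s := by simpa using hs
            have := (List.isChain_cons_cons.1 hch).1
            obtain ⟨_ | _, n⟩ := s'
            · rfl
            · exact absurd rfl this)
      refine ⟨es, h1, h2, ?_, ?_⟩
      · rw [← hsum, ← h3]
        simp [yExponentSum, add_comm]
      · rw [← h3, tracePolynomial, tracePolynomial, evalWord_append, Matrix.trace_mul_comm]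
        simp [evalWord]

/-! ### Zeros outside `[-√3, √3]` -/

/-- By Cayley–Hamilton in determinant one, trace `0` gives square `-1` and trace `1` gives cube
`-1`. -/
theorem containsNonabelianFreeSubgroup_of_matrices {w : Word} {A B : SL(2, ℂ)} {c : ℂ}
    (tA : A.1.trace = 0) (tB : B.1.trace = 1) (tAB : (A.1 * B.1).trace = c)
    (hc : aeval c (intTrace w) = 0) (g k : FreeGroup Gen) {t : ℂ} (ht : 1 < ‖t‖)
    (hg : (FreeGroup.lift (generatorValue A B) g).1 = !![t, 0; 0, t⁻¹])
    (hk : ∀ i j, (FreeGroup.lift (generatorValue A B) k).1 i j ≠ 0) :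
    ContainsNonabelianFreeSubgroup (GeneralisedTriangleGroup 2 3 2 w) := by
  have hAA := mul_self_of_det_eq_one A.2
  have hBB := mul_self_of_det_eq_one B.2
  have hWW := mul_self_of_det_eq_one (evalWord A B w).2
  have hval : (evalWord A B w).1 = evalWord A.1 B.1 w :=
    map_evalWord Matrix.SpecialLinearGroup.coeMonoidHom A B w
  rw [tA, zero_smul, zero_sub] at hAA
  rw [tB, one_smul] at hBB
  rw [hval, trace_evalWord A.2 B.2 tA tB tAB, hc, zero_smul, zero_sub, ← hval] at hWW
  refine containsNonabelianFreeSubgroup_of_representation ?_ ?_ ?_ g k ht hg hk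
  · apply Subtype.ext
    simpa [pow_two] using hAA
  · apply Subtype.ext
    have : B.1 * B.1 * B.1 = -1 := by
      rw [hBB, sub_mul, hBB, one_mul]
      abel
    simpa [pow_succ] using this
  · apply Subtype.ext
    simpa [pow_two] using hWW

/-- The two candidates for `t` are inverse to each other. If both had norm one, `s = 2 Re t` would
be real and in `[-2, 2]`. -/
theorem exists_add_inv_eq {s : ℂ} (hs : ∀ r : ℝ, s = r → 2 < |r|) :
    ∃ t : ℂ, 1 < ‖t‖ ∧ t + t⁻¹ = s := by
  obtain ⟨d, hd⟩ := IsAlgClosed.exists_pow_nat_eq (s ^ 2 - 4) two_pos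
  have h1 : (s + d) / 2 * ((s - d) / 2) = 1 := by linear_combination -hd / 4
  set t : ℂ := (s + d) / 2 with ht
  have hinv : t⁻¹ = (s - d) / 2 := inv_eq_of_mul_eq_one_right h1
  have hsum : t + t⁻¹ = s := by rw [hinv, ht]; ring
  have ht0 : t ≠ 0 := left_ne_zero_of_mul_eq_one h1
  rcases lt_trichotomy ‖t‖ 1 with h | h | h
  · refine ⟨t⁻¹, ?_, by rw [inv_inv, add_comm, hsum]⟩
    rw [norm_inv]
    exact (one_lt_inv₀ (norm_pos_iff.2 ht0)).2 h
  · exfalso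
    have h2 := hs (2 * t.re) (by
      rw [← hsum, Complex.inv_eq_conj h, Complex.add_conj])
    have := Complex.abs_re_le_norm t
    rw [abs_mul, abs_two] at h2
    linarith
  · exact ⟨t, h, hsum⟩

/-- A zero of the trace polynomial outside `[-√3, √3]` gives a free subgroup. -/
theorem containsNonabelianFreeSubgroup_of_root {w : Word} {c : ℂ} (hc : aeval c (intTrace w) = 0)
    (hcr : ∀ r : ℝ, c = r → 3 < r ^ 2) :
    ContainsNonabelianFreeSubgroup (GeneralisedTriangleGroup 2 3 2 w) := by
  by_cases h2 : ∃ r : ℝ, c = r ∧ |r| ≤ 2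
  · obtain ⟨r, rfl, -⟩ := h2
    have hr := hcr r rfl
    -- Here `√3 < |r| ≤ 2` and `AB` is not loxodromic, but the commutator has trace `r² - 1 > 2`.
    -- The matrices below are chosen in a basis that diagonalises it.
    obtain ⟨t, ht, hts⟩ := exists_add_inv_eq (s := ((r ^ 2 - 1 : ℝ) : ℂ)) (by
      intro r' h
      obtain rfl : r ^ 2 - 1 = r' := by exact_mod_cast h
      exact lt_of_lt_of_le (by linarith) (le_abs_self _))
    have ht0 : t ≠ 0 := fun h => by simp [h] at ht; linarith
    have ht1 : 1 + t ≠ 0 := fun h => by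
      rw [← neg_eq_iff_add_eq_zero] at h
      rw [← h] at ht
      simp at ht
    have hr0 : (r : ℂ) ≠ 0 := by
      rintro h
      rw [Complex.ofReal_eq_zero] at h
      rw [h] at hr
      norm_num at hr
    have hrel : t ^ 2 + 1 = ((r : ℂ) ^ 2 - 1) * t := by
      push_cast at hts
      field_simp at hts
      linear_combination hts
    obtain ⟨A, hA⟩ : ∃ A : SL(2, ℂ), A.1 = !![0, 1; -1, 0] :=
      ⟨⟨_, by simp [Matrix.det_fin_two_of]⟩, rfl⟩
    obtain ⟨B, hB⟩ : ∃ B : SL(2, ℂ),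
        B.1 = !![1 / (1 + t), -r / (1 + t); r * t / (1 + t), t / (1 + t)] := by
      refine ⟨⟨_, ?_⟩, rfl⟩
      rw [Matrix.det_fin_two_of]
      field_simp
      linear_combination -hrel
    obtain ⟨D, hD⟩ : ∃ D : SL(2, ℂ), D.1 = !![t, 0; 0, t⁻¹] :=
      ⟨⟨_, by simp [Matrix.det_fin_two_of, ht0]⟩, rfl⟩
    refine containsNonabelianFreeSubgroup_of_matrices (A := A) (B := B) ?_ ?_ ?_ hc
      (FreeGroup.of Gen.x * FreeGroup.of Gen.y * (FreeGroup.of Gen.x)⁻¹ * (FreeGroup.of Gen.y)⁻¹)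
      (FreeGroup.of Gen.y) ht ?_ ?_
    · simp [hA, Matrix.trace_fin_two_of]
    · rw [hB, Matrix.trace_fin_two_of]
      field_simp
    · rw [hA, hB, Matrix.mul_fin_two, Matrix.trace_fin_two_of]
      field_simp
      ring
    · have : A * B * A⁻¹ * B⁻¹ = D := by
        rw [mul_inv_eq_iff_eq_mul, mul_inv_eq_iff_eq_mul]
        apply Subtype.ext
        simp only [Matrix.SpecialLinearGroup.coe_mul, hA, hB, hD, Matrix.mul_fin_two]
        ext i j
        fin_cases i <;> fin_cases j <;> simp <;> field_simp
      simpa [generatorValue, this] using hD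
    · intro i j
      fin_cases i <;> fin_cases j <;> simp [generatorValue, hB, ht0, ht1, hr0]
  · push Not at h2
    obtain ⟨t, ht, hts⟩ := exists_add_inv_eq h2
    have ht0 : t ≠ 0 := fun h => by simp [h] at ht; linarith
    have ht1 : 1 - t ^ 2 ≠ 0 := fun h => by
      have h1 : ‖t‖ ^ 2 = 1 := by rw [← norm_pow, ← sub_eq_zero.1 h, norm_one]
      nlinarith
    have hc3 : c ^ 2 ≠ 3 := by
      intro h
      have h3 : ((√3 : ℝ) : ℂ) ^ 2 = 3 := by
        rw [← Complex.ofReal_pow, Real.sq_sqrt (by norm_num)]; norm_num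
      rcases sq_eq_sq_iff_eq_or_eq_neg.1 (h.trans h3.symm) with h' | h'
      · have := hcr _ h'
        rw [Real.sq_sqrt (by norm_num)] at this
        exact this.false
      · have := hcr (-√3) (by rw [h']; push_cast; rfl)
        rw [neg_sq, Real.sq_sqrt (by norm_num)] at this
        exact this.false
    -- This expression is `t²(c² - 3)`. It vanishes exactly for `c² = 3`, and then `A` below would
    -- have a zero entry.
    have ht3 : 1 - t ^ 2 + t ^ 4 ≠ 0 := by
      intro h
      apply hc3
      rw [← hts]
      field_simp
      linear_combination h
    -- The basis diagonalises `AB`, so `B = A⁻¹ · diag(t, t⁻¹)`; the value of `α` is dictated by `tr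
    -- B = 1`.
    set α : ℂ := t / (1 - t ^ 2) with hα
    have hα0 : α ≠ 0 := div_ne_zero ht0 ht1
    have hα1 : 1 + α ^ 2 ≠ 0 := by
      intro h
      apply ht3
      rw [hα] at h
      field_simp at h
      linear_combination h
    obtain ⟨A, hA⟩ : ∃ A : SL(2, ℂ), A.1 = !![α, 1; -(1 + α ^ 2), -α] :=
      ⟨⟨_, by rw [Matrix.det_fin_two_of]; ring⟩, rfl⟩
    obtain ⟨B, hB⟩ : ∃ B : SL(2, ℂ),
        B.1 = !![-(α * t), -t⁻¹; (1 + α ^ 2) * t, α * t⁻¹] :=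
      ⟨⟨_, by rw [Matrix.det_fin_two_of]; field_simp; ring⟩, rfl⟩
    have hAB : A.1 * B.1 = !![t, 0; 0, t⁻¹] := by
      rw [hA, hB, Matrix.mul_fin_two]
      ext i j
      fin_cases i <;> fin_cases j <;> simp <;> ring
    refine containsNonabelianFreeSubgroup_of_matrices (A := A) (B := B) ?_ ?_ ?_ hc
      (FreeGroup.of Gen.x * FreeGroup.of Gen.y) (FreeGroup.of Gen.x) ht ?_ ?_
    · simp [hA, Matrix.trace_fin_two_of]
    · rw [hB, Matrix.trace_fin_two_of, hα]
      field_simp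
      ring
    · rw [hAB, Matrix.trace_fin_two_of, hts]
    · simpa [generatorValue] using hAB
    · intro i j
      fin_cases i <;> fin_cases j <;> simp [generatorValue, hA, hα0]
      contrapose! hα1
      linear_combination -hα1

/-! ### Special values of the trace polynomial -/

/-- The trace polynomial is bounded by `2` on `[-√3, √3]`, where the representation is unitary. -/
theorem norm_aeval_intTrace_le (w : Word) {r : ℝ} (hr : r ^ 2 ≤ 3) :
    ‖aeval (r : ℂ) (intTrace w)‖ ≤ 2 := by
  -- For `r² ≤ 3` this `s` is real and makes `det B = 1`, so `A` and `B` lie in `SU(2)`.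
  set s : ℝ := √(3 - r ^ 2) / 2 with hs
  have hs2 : s ^ 2 = (3 - r ^ 2) / 4 := by
    rw [hs, div_pow, Real.sq_sqrt (by linarith)]; norm_num
  have hs2' : (s : ℂ) ^ 2 = (3 - (r : ℂ) ^ 2) / 4 := by exact_mod_cast congrArg Complex.ofReal hs2
  set A : Matrix (Fin 2) (Fin 2) ℂ := !![Complex.I, 0; 0, -Complex.I] with hA
  set B : Matrix (Fin 2) (Fin 2) ℂ := !![1 / 2 - r / 2 * Complex.I, s; -s, 1 / 2 + r / 2 * Complex.I]
    with hB
  have hI := Complex.I_sq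
  have h2 : (starRingEnd ℂ) 2 = 2 := map_ofNat _ 2
  have tr : (evalWord A B w).trace = aeval (r : ℂ) (intTrace w) := by
    apply trace_evalWord
    · rw [hA, Matrix.det_fin_two_of]; linear_combination -hI
    · rw [hB, Matrix.det_fin_two_of]; linear_combination -(r : ℂ) ^ 2 / 4 * hI + hs2'
    · rw [hA, Matrix.trace_fin_two_of]; ring
    · rw [hB, Matrix.trace_fin_two_of]; ring
    · rw [hA, hB, Matrix.mul_fin_two, Matrix.trace_fin_two_of]; linear_combination -(r : ℂ) * hI
  have hW : evalWord A B w ∈ Matrix.unitaryGroup (Fin 2) ℂ := by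
    refine evalWord_mem _ ?_ ?_ w
    · rw [Matrix.mem_unitaryGroup_iff, hA, Matrix.star_eq_conjTranspose]
      ext i j
      fin_cases i <;> fin_cases j <;> simp [Matrix.mul_apply, Fin.sum_univ_two]
    · rw [Matrix.mem_unitaryGroup_iff, hB, Matrix.star_eq_conjTranspose]
      ext i j
      fin_cases i <;> fin_cases j <;> simp [Matrix.mul_apply, Fin.sum_univ_two, h2]
      · linear_combination -(r : ℂ) ^ 2 / 4 * hI + hs2'
      · ring
      · ring
      · linear_combination -(r : ℂ) ^ 2 / 4 * hI + hs2'
  rw [← tr, Matrix.trace_fin_two]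
  refine (norm_add_le _ _).trans ?_
  linarith [entry_norm_bound_of_unitary hW 0 0, entry_norm_bound_of_unitary hW 1 1]

/-- The value of the trace polynomial at the reducible representations. -/
theorem aeval_intTrace_sq_of_sq_eq_three {es : List ℕ} (hodd : Odd es.length)
    (hy : ¬ 3 ∣ es.sum) {c : ℂ} (hc : c ^ 2 = 3) :
    aeval c (intTrace (blockWord es)) ^ 2 = 3 := by
  have hI := Complex.I_sq
  set u : ℂ := (1 - Complex.I * c) / 2 with hu
  set v : ℂ := (1 + Complex.I * c) / 2 with hv
  have huv : u * v = 1 := by rw [hu, hv]; linear_combination (-c ^ 2 * hI + hc) / 4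
  have huv' : u + v = 1 := by rw [hu, hv]; ring
  set A : Matrix (Fin 2) (Fin 2) ℂ := !![Complex.I, 0; 0, -Complex.I] with hA
  set B : Matrix (Fin 2) (Fin 2) ℂ := !![u, 0; 0, v] with hB
  have tr : (evalWord A B (blockWord es)).trace = aeval c (intTrace (blockWord es)) := by
    apply trace_evalWord
    · rw [hA, Matrix.det_fin_two_of]; linear_combination -hI
    · rw [hB, Matrix.det_fin_two_of]; linear_combination huv
    · rw [hA, Matrix.trace_fin_two_of]; ring
    · rw [hB, Matrix.trace_fin_two_of, huv']
    · rw [hA, hB, Matrix.mul_fin_two, Matrix.trace_fin_two_of, hu, hv]; linear_combination -c * hI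
  have hpow : ∀ n, B ^ n = !![u ^ n, 0; 0, v ^ n] := by
    intro n
    induction n with
    | zero => ext i j; fin_cases i <;> fin_cases j <;> simp
    | succ n ih =>
      rw [pow_succ, ih, hB, Matrix.mul_fin_two, pow_succ, pow_succ]
      simp
  have heval : ∀ es : List ℕ, evalWord A B (blockWord es) =
      !![Complex.I ^ es.length * u ^ es.sum, 0; 0, (-Complex.I) ^ es.length * v ^ es.sum] := by
    intro es
    induction es with
    | nil => ext i j; fin_cases i <;> fin_cases j <;> simp [blockWord, evalWord]
    | cons e es ih =>
      rw [blockWord_cons, evalWord_cons, evalWord_cons, ih, evalSyllable, evalSyllable, pow_one,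
        hpow, hA, Matrix.mul_fin_two, Matrix.mul_fin_two]
      ext i j
      fin_cases i <;> fin_cases j <;> simp <;> ring
  rw [← tr, heval, Matrix.trace_fin_two_of]
  obtain ⟨m, hm⟩ := hodd
  have hI1 : (Complex.I ^ es.length) ^ 2 = -1 := by
    rw [← pow_mul, mul_comm, pow_mul, hI, hm, pow_succ, pow_mul]; simp
  have hI2 : (-Complex.I) ^ es.length = - Complex.I ^ es.length := Odd.neg_pow ⟨m, hm⟩ _
  have hu3 : u ^ 3 = -1 := by linear_combination (u + 1) * (u * huv' - huv)
  have hv3 : v ^ 3 = -1 := by linear_combination (v + 1) * (v * huv' - huv)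
  -- `u` and `v` are the primitive sixth roots of unity; as `3` does not divide the exponent, the
  -- two squares are the primitive cube roots of unity.
  have hk : (u ^ es.sum) ^ 2 + (v ^ es.sum) ^ 2 = -1 := by
    have hdm := Nat.div_add_mod es.sum 3
    have hlt := Nat.mod_lt es.sum (by norm_num : 3 > 0)
    have hne : es.sum % 3 ≠ 0 := fun h => hy (Nat.dvd_of_mod_eq_zero h)
    have hq : (((-1 : ℂ)) ^ (es.sum / 3)) ^ 2 = 1 := by
      rw [← pow_mul, mul_comm, pow_mul]; simp
    rw [← hdm, pow_add, pow_add, pow_mul, pow_mul, hu3, hv3, mul_pow, mul_pow, hq, one_mul, one_mul]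
    obtain h | h : es.sum % 3 = 1 ∨ es.sum % 3 = 2 := by omega
    · rw [h]; linear_combination (u + v + 1) * huv' - 2 * huv
    · rw [h]; linear_combination u * hu3 + v * hv3 - huv'
  have huvk : u ^ es.sum * v ^ es.sum = 1 := by rw [← mul_pow, huv, one_pow]
  rw [hI2]
  linear_combination (u ^ es.sum - v ^ es.sum) ^ 2 * hI1 - hk + 2 * huvk

/-- Replacing `A` by `-A` turns `tr AB = 2` into `-2` and changes `W` only by a sign. -/
theorem aeval_neg_two_intTrace_sq (es : List ℕ) :
    aeval (-2 : ℤ) (intTrace (blockWord es)) ^ 2 = aeval (2 : ℤ) (intTrace (blockWord es)) ^ 2 := by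
  set A : Matrix (Fin 2) (Fin 2) ℤ := !![0, 1; -1, 0] with hA
  set B : Matrix (Fin 2) (Fin 2) ℤ := !![0, -1; 1, 1] with hB
  have h1 : (evalWord A B (blockWord es)).trace = aeval 2 (intTrace (blockWord es)) := by
    apply trace_evalWord <;> decide
  have h2 : (evalWord (-A) B (blockWord es)).trace = aeval (-2) (intTrace (blockWord es)) := by
    apply trace_evalWord <;> decide
  have h3 : evalWord (-A) B (blockWord es) = (-1 : ℤ) ^ es.length • evalWord A B (blockWord es) := by
    clear h1 h2
    induction es with
    | nil => simp [blockWord, evalWord]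
    | cons e es ih =>
      rw [blockWord_cons, evalWord_cons, evalWord_cons, ih, evalWord_cons, evalWord_cons]
      simp only [evalSyllable, pow_zero, one_mul, Matrix.mul_smul, neg_mul, List.length_cons, pow_succ,
        mul_neg, mul_one, neg_smul]
  rw [← h1, ← h2, h3, Matrix.trace_smul, smul_eq_mul, mul_pow, ← pow_mul, mul_comm _ 2, pow_mul]
  simp

/-! ### Arithmetic of the zeros and factorisation -/

theorem abs_cubic_lt_one {u : ℝ} (h0 : 0 ≤ u) (h1 : u ≤ 9 / 4) : |u * (u - 1) * (u - 2)| < 1 := by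
  rw [abs_lt]
  constructor
  · nlinarith [mul_nonneg h0 (sq_nonneg (u - 3 / 2)), sq_nonneg (u - 3 / 2)]
  · nlinarith [mul_nonneg h0 (sq_nonneg (u - 3 / 2)), mul_nonneg h0 (sub_nonneg.2 h1),
      mul_nonneg (mul_nonneg h0 (sub_nonneg.2 h1)) h0]

/-- An algebraic integer all of whose conjugates have absolute value less than `1` is zero. -/
theorem eq_zero_of_norm_embedding_lt_one {K : Type*} [Field K] [NumberField K] {v : K}
    (hv : IsIntegral ℤ v) (h : ∀ σ : K →ₐ[ℚ] ℂ, ‖σ v‖ < 1) : v = 0 := by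
  by_contra hne
  -- The norm is a rational integer and the product of all conjugates, hence of absolute value less
  -- than `1`.
  obtain ⟨n, hn⟩ := IsIntegrallyClosed.isIntegral_iff.1 (Algebra.isIntegral_norm ℚ hv)
  have hprod := Algebra.norm_eq_prod_embeddings ℚ ℂ v
  have hlt : ‖algebraMap ℚ ℂ (Algebra.norm ℚ v)‖ < 1 := by
    rw [hprod, norm_prod]
    calc ∏ σ : K →ₐ[ℚ] ℂ, ‖σ v‖ < ∏ σ : K →ₐ[ℚ] ℂ, 1 := by
          have : Nonempty (K →ₐ[ℚ] ℂ) := ⟨IsAlgClosed.lift⟩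
          refine Finset.prod_lt_prod_of_nonempty (fun σ _ => ?_) (fun σ _ => h σ)
            Finset.univ_nonempty
          rw [norm_pos_iff]
          exact (map_ne_zero σ).2 hne
      _ = 1 := by simp
  rw [← hn] at hlt
  have hn0 : n = 0 := by
    simp at hlt
    rw [← Int.cast_abs] at hlt
    exact Int.abs_lt_one_iff.1 (by exact_mod_cast hlt)
  rw [hn0, map_zero] at hn
  exact hne (Algebra.norm_eq_zero_iff.1 hn.symm)

/-- Algebraic integers whose conjugates lie in `[-√3, √3]`. -/
theorem cubic_eq_zero_of_root {P : ℤ[X]} (hP : P.Monic)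
    (hreal : ∀ z : ℂ, aeval z P = 0 → ∃ r : ℝ, z = r ∧ r ^ 2 ≤ 3) {z : ℂ} (hz : aeval z P = 0) :
    z ^ 2 * (3 - z ^ 2) * (z ^ 2 * (3 - z ^ 2) - 1) * (z ^ 2 * (3 - z ^ 2) - 2) = 0 := by
  have hzi : IsIntegral ℤ z := ⟨P, hP, hz⟩
  have hzQ : IsIntegral ℚ z := hzi.tower_top
  have : FiniteDimensional ℚ (IntermediateField.adjoin ℚ {z}) :=
    IntermediateField.adjoin.finiteDimensional hzQ
  have : NumberField (IntermediateField.adjoin ℚ {z}) := ⟨⟩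
  set g : IntermediateField.adjoin ℚ {z} := IntermediateField.AdjoinSimple.gen ℚ z with hg
  have hgz : algebraMap (IntermediateField.adjoin ℚ {z}) ℂ g = z :=
    IntermediateField.AdjoinSimple.algebraMap_gen ℚ z
  have hinj := FaithfulSMul.algebraMap_injective (IntermediateField.adjoin ℚ {z}) ℂ
  have hgP : aeval g P = 0 := by
    apply hinj
    rw [← aeval_algebraMap_apply, hgz, hz, map_zero]
  have hgi : IsIntegral ℤ g := ⟨P, hP, hgP⟩
  have hv := eq_zero_of_norm_embedding_lt_one
    (v := g ^ 2 * (3 - g ^ 2) * (g ^ 2 * (3 - g ^ 2) - 1) * (g ^ 2 * (3 - g ^ 2) - 2)) ?_ ?_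
  · rw [← hgz]
    have := congrArg (algebraMap (IntermediateField.adjoin ℚ {z}) ℂ) hv
    simpa only [map_mul, map_sub, map_pow, map_ofNat, map_one, map_zero] using this
  · have h3 : IsIntegral ℤ (3 : IntermediateField.adjoin ℚ {z}) := by
      simpa using isIntegral_algebraMap (R := ℤ) (A := IntermediateField.adjoin ℚ {z}) (x := 3)
    have h2 : IsIntegral ℤ (2 : IntermediateField.adjoin ℚ {z}) := by
      simpa using isIntegral_algebraMap (R := ℤ) (A := IntermediateField.adjoin ℚ {z}) (x := 2)
    have hu := (hgi.pow 2).mul (h3.sub (hgi.pow 2))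
    exact (hu.mul (hu.sub isIntegral_one)).mul (hu.sub h2)
  -- Every conjugate of `z` is again a zero of `P`, so `hreal` applies to it; `9 / 4` is the maximum
  -- of `m(3 - m)`, at `m = 3/2`.
  · intro σ
    have hσ : aeval (σ g) P = 0 := by
      have := congrArg (σ.restrictScalars ℤ) hgP
      rwa [← aeval_algHom_apply, map_zero] at this
    obtain ⟨r, hr, hr3⟩ := hreal _ hσ
    have : σ (g ^ 2 * (3 - g ^ 2) * (g ^ 2 * (3 - g ^ 2) - 1) * (g ^ 2 * (3 - g ^ 2) - 2))
        = ((r ^ 2 * (3 - r ^ 2) * (r ^ 2 * (3 - r ^ 2) - 1) * (r ^ 2 * (3 - r ^ 2) - 2) : ℝ) : ℂ) := by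
      simp only [map_mul, map_sub, map_pow, map_ofNat, map_one, hr]
      push_cast
      rfl
    rw [this, Complex.norm_real, Real.norm_eq_abs]
    exact abs_cubic_lt_one (mul_nonneg (sq_nonneg r) (by linarith))
      (by nlinarith [sq_nonneg (r ^ 2 - 3 / 2)])

/-- The hypothesis `hz` is a completed square with discriminant `D`; as `D` is not a square, `z` is
irrational. -/
theorem eq_zero_of_mul_add_eq_zero {z : ℂ} {D m : ℤ} (hD : ¬ IsSquare D)
    (hz : (2 * z + m) ^ 2 = D) {a b : ℤ} (h : (a : ℂ) * z + b = 0) : a = 0 ∧ b = 0 := by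
  have h1 : a ^ 2 * D = (a * m - 2 * b) ^ 2 := by
    have : ((a ^ 2 * D : ℤ) : ℂ) = ((a * m - 2 * b) ^ 2 : ℤ) := by
      push_cast
      rw [← hz]
      linear_combination (4 * (a * z - b) + 4 * a * m) * h
    exact_mod_cast this
  have ha : a = 0 := by
    by_contra ha
    obtain ⟨q, hq⟩ := (Int.pow_dvd_pow_iff two_ne_zero).1 ⟨D, h1.symm⟩
    rw [hq, mul_pow] at h1
    exact hD ⟨q, by rw [mul_left_cancel₀ (pow_ne_zero 2 ha) h1, pow_two]⟩
  subst ha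
  simpa using h

/-- An irreducible monic quadratic polynomial divides every integer polynomial with which it has a
zero in common. -/
theorem quadratic_dvd {P q : ℤ[X]} (hq : q.Monic) (hq2 : q.natDegree = 2) {z : ℂ} {D m : ℤ}
    (hD : ¬ IsSquare D) (hz : (2 * z + m) ^ 2 = D) (hqz : aeval z q = 0) (hPz : aeval z P = 0) :
    q ∣ P := by
  rw [← modByMonic_eq_zero_iff_dvd hq]
  have hdeg : (P %ₘ q).natDegree ≤ 1 := by
    have := natDegree_modByMonic_lt P hq (by rintro rfl; simp at hq2)
    omega
  have hr : aeval z (P %ₘ q) = 0 := by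
    have := congrArg (aeval z) (modByMonic_add_div P q)
    rwa [map_add, map_mul, hqz, zero_mul, add_zero, hPz] at this
  rw [eq_X_add_C_of_natDegree_le_one hdeg] at hr ⊢
  obtain ⟨h1, h0⟩ := eq_zero_of_mul_add_eq_zero hD hz (by simpa using hr)
  simp [h1, h0]

theorem linear_dvd {P : ℤ[X]} {m : ℤ} (h : aeval (m : ℂ) P = 0) : X - C m ∣ P := by
  rw [dvd_iff_isRoot, IsRoot]
  have := aeval_algebraMap_apply ℂ m P
  simp only [algebraMap_int_eq, eq_intCast, h] at this
  simpa using this.symm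

theorem not_isSquare_five : ¬ IsSquare (5 : ℤ) := by
  rintro ⟨k, hk⟩
  have h1 : k ≤ 2 := by nlinarith
  have h2 : -2 ≤ k := by nlinarith
  interval_cases k <;> omega

theorem not_isSquare_eight : ¬ IsSquare (8 : ℤ) := by
  rintro ⟨k, hk⟩
  have h1 : k ≤ 2 := by nlinarith
  have h2 : -2 ≤ k := by nlinarith
  interval_cases k <;> omega

/-- Factorisation of a monic integer polynomial with zeros in a prescribed finite set. -/
theorem exists_factorization {P : ℤ[X]} (hP : P.Monic)
    (hroots : ∀ z : ℂ, aeval z P = 0 →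
      z ^ 2 * (3 - z ^ 2) * (z ^ 2 * (3 - z ^ 2) - 1) * (z ^ 2 * (3 - z ^ 2) - 2) = 0)
    (h3 : ∀ z : ℂ, aeval z P = 0 → z ^ 2 ≠ 3) :
    ∃ a b b' c e e' : ℕ, P = X ^ a * (X - 1) ^ b * (X + 1) ^ b' * (X ^ 2 - 2) ^ c *
        (X ^ 2 - X - 1) ^ e * (X ^ 2 + X - 1) ^ e' ∧
      P.natDegree = a + b + b' + 2 * c + 2 * e + 2 * e' := by
  induction hn : P.natDegree using Nat.strong_induction_on generalizing P with
  | _ n ih =>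
  by_cases hn0 : n = 0
  · subst hn0
    exact ⟨0, 0, 0, 0, 0, 0, by simpa using hP.natDegree_eq_zero.1 hn, rfl⟩
  have step : ∀ q : ℤ[X], q.Monic → q.natDegree ≠ 0 → q ∣ P →
      ∃ a b b' c e e' : ℕ, P = q * (X ^ a * (X - 1) ^ b * (X + 1) ^ b' * (X ^ 2 - 2) ^ c *
        (X ^ 2 - X - 1) ^ e * (X ^ 2 + X - 1) ^ e') ∧
      n = q.natDegree + (a + b + b' + 2 * c + 2 * e + 2 * e') := by
    rintro q hq hq0 ⟨P', rfl⟩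
    have hP' : P'.Monic := hq.of_mul_monic_left hP
    have hdeg := hq.natDegree_mul hP'
    have hz : ∀ z : ℂ, aeval z P' = 0 → aeval z (q * P') = 0 := fun z h => by
      rw [map_mul, h, mul_zero]
    obtain ⟨a, b, b', c, e, e', h1, h2⟩ := ih P'.natDegree (by omega) hP'
      (fun z h => hroots z (hz z h)) (fun z h => h3 z (hz z h)) rfl
    exact ⟨a, b, b', c, e, e', by rw [← h1], by omega⟩
  obtain ⟨z, hz⟩ : ∃ z : ℂ, aeval z P = 0 :=
    IsAlgClosed.exists_aeval_eq_zero _ P (by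
      rw [degree_eq_natDegree hP.ne_zero, hn]
      exact_mod_cast hn0)
  have hm1 : (X - 1 : ℤ[X]).Monic ∧ (X - 1 : ℤ[X]).natDegree = 1 := by
    rw [← C_1]; exact ⟨monic_X_sub_C 1, natDegree_X_sub_C 1⟩
  have hm2 : (X + 1 : ℤ[X]).Monic ∧ (X + 1 : ℤ[X]).natDegree = 1 := by
    rw [← C_1]; exact ⟨monic_X_add_C 1, natDegree_X_add_C 1⟩
  have hm3 : (X ^ 2 - 2 : ℤ[X]).Monic ∧ (X ^ 2 - 2 : ℤ[X]).natDegree = 2 := by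
    constructor
    · monicity!
    · compute_degree!
  have hm4 : (X ^ 2 - X - 1 : ℤ[X]).Monic ∧ (X ^ 2 - X - 1 : ℤ[X]).natDegree = 2 := by
    constructor
    · monicity!
    · compute_degree!
  have hm5 : (X ^ 2 + X - 1 : ℤ[X]).Monic ∧ (X ^ 2 + X - 1 : ℤ[X]).natDegree = 2 := by
    constructor
    · monicity!
    · compute_degree!
  have hcases : z = 0 ∨ z = 1 ∨ z = -1 ∨ z ^ 2 = 2 ∨ z ^ 2 - z - 1 = 0 ∨ z ^ 2 + z - 1 = 0 := by
    -- With `u = z²(3 - z²)`: `1 - u = (z² - z - 1)(z² + z - 1)` and `2 - u = (z² - 1)(z² - 2)`.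
    have h0 : z ^ 2 * ((z - 1) * ((z + 1) * ((z ^ 2 - 2) * ((z ^ 2 - z - 1) * (z ^ 2 + z - 1))))) = 0 := by
      refine (mul_eq_zero.1 ?_).resolve_right (sub_ne_zero.2 (h3 z hz).symm)
      linear_combination hroots z hz
    simpa [sub_eq_zero, eq_neg_iff_add_eq_zero] using h0
  rcases hcases with h | h | h | h | h | h
  · obtain ⟨a, b, b', c, e, e', h1, h2⟩ := step X monic_X (by simp)
      (by simpa using linear_dvd (m := 0) (by simpa [h] using hz))
    exact ⟨a + 1, b, b', c, e, e', by rw [h1]; ring, by rw [h2, natDegree_X]; ring⟩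
  · obtain ⟨a, b, b', c, e, e', h1, h2⟩ := step (X - 1) hm1.1 (by simp [hm1.2])
      (by simpa using linear_dvd (m := 1) (by simpa [h] using hz))
    exact ⟨a, b + 1, b', c, e, e', by rw [h1]; ring, by rw [h2, hm1.2]; ring⟩
  · obtain ⟨a, b, b', c, e, e', h1, h2⟩ := step (X + 1) hm2.1 (by simp [hm2.2])
      (by simpa using linear_dvd (m := -1) (by simpa [h] using hz))
    exact ⟨a, b, b' + 1, c, e, e', by rw [h1]; ring, by rw [h2, hm2.2]; ring⟩
  · obtain ⟨a, b, b', c, e, e', h1, h2⟩ := step (X ^ 2 - 2) hm3.1 (by simp [hm3.2])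
      (quadratic_dvd hm3.1 hm3.2 (m := 0) not_isSquare_eight
        (by push_cast; linear_combination 4 * h) (by simp [h, map_ofNat]) hz)
    exact ⟨a, b, b', c + 1, e, e', by rw [h1]; ring, by rw [h2, hm3.2]; ring⟩
  · obtain ⟨a, b, b', c, e, e', h1, h2⟩ := step (X ^ 2 - X - 1) hm4.1 (by simp [hm4.2])
      (quadratic_dvd hm4.1 hm4.2 (m := -1) not_isSquare_five
        (by push_cast; linear_combination 4 * h) (by simp [h]) hz)
    exact ⟨a, b, b', c, e + 1, e', by rw [h1]; ring, by rw [h2, hm4.2]; ring⟩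
  · obtain ⟨a, b, b', c, e, e', h1, h2⟩ := step (X ^ 2 + X - 1) hm5.1 (by simp [hm5.2])
      (quadratic_dvd hm5.1 hm5.2 (m := 1) not_isSquare_five
        (by push_cast; linear_combination 4 * h) (by simp [h]) hz)
    exact ⟨a, b, b', c, e, e' + 1, by rw [h1]; ring, by rw [h2, hm5.2]; ring⟩

/-! ### Determination of the exponents -/

theorem exponents_of_mul_eq_nine {a n : ℕ} (h : 9 ^ a * 4 ^ n = 9) : a = 1 ∧ n = 0 := by
  have hn : n = 0 := by
    by_contra hn
    have h2 : 2 ∣ 9 ^ a * 4 ^ n := dvd_mul_of_dvd_right (dvd_pow (by norm_num) hn) _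
    rw [h] at h2
    omega
  subst hn
  exact ⟨Nat.pow_right_injective (le_refl 2 |>.trans (by norm_num : 2 ≤ 9)) (by simpa using h), rfl⟩

/-- The bounds on the exponents come from the values at `λ² = 13/10` and `λ² = 1/50`. -/
theorem exponent_bounds {c e : ℕ}
    (h : ∀ r : ℝ, r ^ 2 ≤ 3 → |r * (r ^ 2 - 2) ^ c * (r ^ 4 - 3 * r ^ 2 + 1) ^ e| ≤ 2) :
    c ≤ 4 ∧ e ≤ 2 * c + 2 := by
  have key : ∀ m : ℝ, 0 ≤ m → m ≤ 3 →
      m * ((m - 2) ^ 2) ^ c * ((m ^ 2 - 3 * m + 1) ^ 2) ^ e ≤ 4 := by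
    intro m h0 h3
    have hs : √m ^ 2 = m := Real.sq_sqrt h0
    have h1 := h (√m) (by rw [hs]; exact h3)
    have h2 := pow_le_pow_left₀ (abs_nonneg _) h1 2
    rw [sq_abs, mul_pow, mul_pow, show √m ^ 4 = m ^ 2 by rw [pow_mul _ 2 2, hs], hs, pow_right_comm,
      pow_right_comm _ e] at h2
    linarith
  have he : e ≤ 2 * c + 2 := by
    by_contra! hlt
    obtain ⟨d, rfl⟩ := Nat.exists_eq_add_of_lt hlt
    -- At this point `(m² - 3m + 1)² = 1.4641` and `0.49 · 1.4641² > 1`, so `e = 2c + 3 + d` gives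
    -- at least `1.3 · 1.4641³ > 4`.
    have h1 := key (13 / 10) (by norm_num) (by norm_num)
    norm_num at h1
    have h2 : (1 : ℝ) ≤ (14641 / 10000) ^ d := one_le_pow₀ (by norm_num)
    have h3 : (1 : ℝ) ≤ (49 / 100 * (14641 / 10000) ^ 2) ^ c := one_le_pow₀ (by norm_num)
    have h4 : (13 / 10 : ℝ) * (49 / 100) ^ c * (14641 / 10000) ^ (2 * c + 2 + d + 1)
        = 13 / 10 * (14641 / 10000) ^ 3 *
          ((49 / 100 * (14641 / 10000) ^ 2) ^ c * (14641 / 10000) ^ d) := by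
      rw [mul_pow, ← pow_mul]; ring
    rw [h4] at h1
    have h5 := one_le_mul_of_one_le_of_one_le h3 h2
    norm_num at h1 h5
    linarith
  refine ⟨?_, he⟩
  by_contra! hlt
  obtain ⟨d, rfl⟩ := Nat.exists_eq_add_of_lt hlt
  -- Near `m = 0` the factor `(m - 2)²` is almost `4` and the other base is slightly below `1`. The
  -- bound `e ≤ 2c + 2` limits the loss, and the value at `c = 5` already exceeds `4`.
  have h1 := key (1 / 50) (by norm_num) (by norm_num)
  have h2 : ((((1 / 50 : ℝ)) ^ 2 - 3 * (1 / 50) + 1) ^ 2) ^ (2 * (4 + d + 1) + 2) ≤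
      ((((1 / 50 : ℝ)) ^ 2 - 3 * (1 / 50) + 1) ^ 2) ^ e :=
    pow_le_pow_of_le_one (by norm_num) (by norm_num) he
  have h3 : (1 / 50 : ℝ) * ((1 / 50 - 2) ^ 2) ^ (4 + d + 1) *
      ((((1 / 50 : ℝ)) ^ 2 - 3 * (1 / 50) + 1) ^ 2) ^ (2 * (4 + d + 1) + 2) ≤ 4 :=
    (mul_le_mul_of_nonneg_left h2 (by positivity)).trans h1
  have h4 : ∀ p q : ℝ, 1 / 50 * p ^ (4 + d + 1) * q ^ (2 * (4 + d + 1) + 2)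
      = 1 / 50 * p ^ 5 * q ^ 12 * (p * q ^ 2) ^ d := by
    intro p q
    rw [mul_pow, ← pow_mul]
    ring
  rw [h4] at h3
  have h5 : (1 : ℝ) ≤ ((1 / 50 - 2) ^ 2 * (((1 / 50 : ℝ) ^ 2 - 3 * (1 / 50) + 1) ^ 2) ^ 2) ^ d :=
    one_le_pow₀ (by norm_num)
  have h6 : (4 : ℝ) < 1 / 50 * ((1 / 50 - 2) ^ 2) ^ 5 *
      (((1 / 50 : ℝ) ^ 2 - 3 * (1 / 50) + 1) ^ 2) ^ 12 := by norm_num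
  exact absurd h3 (not_le.2 (h6.trans_le (le_mul_of_one_le_right (by positivity) h5)))

end TriangleGroup

theorem mainTheorem4 (ℓ : ℕ) (w : TriangleGroup.Word)
    (hred : TriangleGroup.IsCyclicallyReduced 2 3 w)
    (hlen : w.length = 2 * ℓ)
    (hodd : Odd ℓ)
    (hy : ¬ 3 ∣ TriangleGroup.yExponentSum w)
    (hfree : ¬ TriangleGroup.ContainsNonabelianFreeSubgroup
      (TriangleGroup.GeneralisedTriangleGroup 2 3 2 w)) :
    ∃ c e : ℕ,
      TriangleGroup.tracePolynomial 2 3 w =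
        Polynomial.X * (Polynomial.X ^ 2 - 2) ^ c *
          (Polynomial.X ^ 4 - 3 * Polynomial.X ^ 2 + 1) ^ e ∧
      c ≤ 4 ∧ e ≤ 2 * c + 2 ∧ ℓ = 1 + 2 * c + 4 * e ∧ ℓ ≤ 49 := by
  open TriangleGroup in
  obtain ⟨es, hes, h12, hsum, hτ⟩ := exists_blockWord hred hlen
  have hint : intTrace w = intTrace (blockWord es) := by
    rw [tracePolynomial_eq_map, tracePolynomial_eq_map] at hτ
    exact Polynomial.map_injective _ Int.cast_injective hτ
  rw [tracePolynomial_eq_map]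
  obtain ⟨hmon, hdeg⟩ := intTrace_blockWord es h12 (by
    rintro rfl
    subst hes
    exact absurd hodd (by decide))
  have hsq : ∀ z : ℂ, z ^ 2 = 3 → aeval z (intTrace w) ^ 2 = 3 := by
    intro z hz
    rw [hint]
    exact aeval_intTrace_sq_of_sq_eq_three (by rwa [hes]) (by rwa [hsum]) hz
  have hreal : ∀ z : ℂ, aeval z (intTrace w) = 0 → ∃ r : ℝ, z = r ∧ r ^ 2 ≤ 3 := by
    intro z hz
    by_contra! hcon
    exact hfree (containsNonabelianFreeSubgroup_of_root hz hcon)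
  have htwo := aeval_neg_two_intTrace_sq es
  rw [← hint] at hmon hdeg htwo
  have hbound := fun (r : ℝ) (hr : r ^ 2 ≤ 3) => norm_aeval_intTrace_le w hr
  obtain ⟨a, b, b', c, e, e', hP, hd⟩ := exists_factorization hmon
    (fun z => cubic_eq_zero_of_root hmon hreal) (fun z hz h3 => by
      have := hsq z h3
      rw [hz] at this
      norm_num at this)
  rw [hdeg, hes] at hd
  generalize intTrace w = P at *
  -- At `s² = 3` the product of the values at `s` and `-s` is `-3` for the factor `λ`, `-2` for `λ -
  -- 1` and for `λ + 1`, and `1` for the quadratic factors.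
  obtain ⟨rfl, hbb⟩ : a = 1 ∧ b + b' = 0 := by
    obtain ⟨s, hs⟩ := IsAlgClosed.exists_pow_nat_eq (3 : ℂ) two_pos
    have h1 := hsq s hs
    have h2 := hsq (-s) (by rw [neg_sq, hs])
    have h3 : aeval s P * aeval (-s) P = (-3) ^ a * ((-2) ^ b * (-2) ^ b') := by
      have e1 : s * -s = -3 := by linear_combination -hs
      have e2 : (s - 1) * (-s - 1) = -2 := by linear_combination -hs
      have e3 : (s + 1) * (-s + 1) = -2 := by linear_combination -hs
      have e4 : (s ^ 2 - 2) * ((-s) ^ 2 - 2) = 1 := by linear_combination (s ^ 2 - 1) * hs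
      have e5 : (s ^ 2 - s - 1) * ((-s) ^ 2 - -s - 1) = 1 := by linear_combination s ^ 2 * hs
      have e6 : (s ^ 2 + s - 1) * ((-s) ^ 2 + -s - 1) = 1 := by linear_combination s ^ 2 * hs
      rw [hP]
      simp only [map_mul, map_pow, map_sub, map_add, aeval_X, map_one, map_ofNat]
      calc _ = (s * -s) ^ a * (((s - 1) * (-s - 1)) ^ b * ((s + 1) * (-s + 1)) ^ b') *
            (((s ^ 2 - 2) * ((-s) ^ 2 - 2)) ^ c * ((s ^ 2 - s - 1) * ((-s) ^ 2 - -s - 1)) ^ e *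
              ((s ^ 2 + s - 1) * ((-s) ^ 2 + -s - 1)) ^ e') := by
            simp only [mul_pow]; ring
        _ = _ := by rw [e1, e2, e3, e4, e5, e6]; simp
    refine exponents_of_mul_eq_nine ?_
    have h4 : ((9 ^ a * 4 ^ (b + b') : ℕ) : ℂ) = (9 : ℕ) := by
      calc ((9 ^ a * 4 ^ (b + b') : ℕ) : ℂ)
          = ((-3) ^ 2) ^ a * (((-2) ^ 2) ^ b * ((-2) ^ 2) ^ b') := by push_cast; norm_num; ring
        _ = ((-3) ^ a * ((-2) ^ b * (-2) ^ b')) ^ 2 := by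
            rw [mul_pow, mul_pow, pow_right_comm, pow_right_comm _ 2 b, pow_right_comm _ 2 b']
        _ = aeval s P ^ 2 * aeval (-s) P ^ 2 := by rw [← h3, mul_pow]
        _ = (9 : ℕ) := by rw [h1, h2]; norm_num
    exact_mod_cast h4
  obtain ⟨rfl, rfl⟩ : b = 0 ∧ b' = 0 := by omega
  -- At `2` the factors `λ² - λ - 1` and `λ² + λ - 1` take the values `1` and `5`, at `-2` the
  -- values `5` and `1`.
  obtain rfl : e = e' := by
    rw [hP] at htwo
    simp only [map_mul, map_pow, map_sub, map_add, aeval_X, map_one, map_ofNat] at htwo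
    norm_num at htwo
    have h1 : (2 * 2 ^ c : ℤ) ^ 2 * (5 ^ e) ^ 2 = (2 * 2 ^ c) ^ 2 * (5 ^ e') ^ 2 := by
      linear_combination htwo
    have h2 := mul_left_cancel₀ (by positivity) h1
    rw [← pow_mul, ← pow_mul] at h2
    have h3 : e * 2 = e' * 2 := Int.pow_right_injective (by norm_num) h2
    omega
  have hP' : P = X * (X ^ 2 - 2) ^ c * (X ^ 4 - 3 * X ^ 2 + 1) ^ e := by
    have : (X ^ 4 - 3 * X ^ 2 + 1 : ℤ[X]) = (X ^ 2 - X - 1) * (X ^ 2 + X - 1) := by ring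
    rw [hP, this, mul_pow]
    ring
  obtain ⟨hc, he⟩ := exponent_bounds (c := c) (e := e) (fun r hr => by
    have h1 := hbound r hr
    rw [hP'] at h1
    simp only [map_mul, map_pow, map_sub, map_add, aeval_X, map_one, map_ofNat] at h1
    rw [← Real.norm_eq_abs, ← Complex.norm_real]
    push_cast
    exact h1)
  refine ⟨c, e, ?_, hc, he, by omega, by omega⟩
  rw [hP']
  simp
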